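/- A trivalent graph is a finite graph, with loops and multiple edges allowed, all of whose vertices have degree $3$ (trinodes) or $1$ (leaves). A caterpillar tree is a trivalent tree in which every trinode is joined by an edge to a leaf (the single edge with two leaves and no trinode is included). A caterpillar graph is a trivalent graph obtained, up to isomorphism, from a caterpillar tree $T$ by finitely many (possibly zero) steps, each of which either attaches a loop at a leaf (the leaf becomes a trinode carrying the loop) or inserts a doubled edge in the interior of an edge whose removal disconnects the graph, in such a way that at the end every trinode of $T$ is still joined by an edge to a leaf. (Hence, when $T$ has a trinode, loops are attached only at the head and the tail, and the leaf edges along the body are left unchanged.) Let $\Gamma$ be a trivalent graph with edge set $E$ and leaves labelled by a finite set $\Lambda$, let $\vec r=(r_\ell)_{\ell\in\Lambda}$ be a vector of non-negative integers and let $L\ge 0$ be an integer. Let $P_\Gamma(\vec r,L)\subset\mathbb R^{E}$ be the set of weightings $w\ge 0$ of the edges such that, at every trinode, the three incident weights $w_1,w_2,w_3$ (a loop being counted twice) satisfy $|w_1-w_2|\le w_3\le w_1+w_2$ and $w_1+w_2+w_3\le 2L$, and such that the edge at the leaf $\ell$ has weight $r_\ell$ for every $\ell\in\Lambda$. The lattice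 is the group of integer weightings of $E$ for which $w_1+w_2+w_3$ is even at every trinode. For $P=P_\Gamma(\vec r,L)$ let $\mathbb C[P]$ be the graded algebra whose component of degree $m\ge 0$ has as a basis the lattice points of the $m$-fold Minkowski sum $mP=P+\dots+P$ (with $0P=\{0\}$), with multiplication given by addition of lattice points. Let $X_P$ be the set of lattice points of $P$ and let $I_P$ be the kernel of the homomorphism $\mathbb C[X_P]\to\mathbb C[P]$ that sends the variable of a lattice point to that lattice point in degree $1$. Theorem. Let $\Gamma$ be a caterpillar graph, $\vec r$ a vector of non-negative integers indexed by its leaves, and $L\ge 0$ an integer. Then the algebra $\mathbb C[P_\Gamma(2\vec r,2L)]$ is generated in degree $1$. Moreover, for some monomial order, the ideal $I_{P_\Gamma(2\vec r,2L)}$ has a finite Gröbner basis that consists of non-zero homogeneous polynomials of degree $2$ whose leading monomials are square-free. -/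

import Mathlib

/-- A finite trivalent graph, with loops and multiple edges allowed.  Its vertices are the trinodes
(the elements of `V`, of degree `3`) and the leaves (the elements of `Leaf`, of degree `1`).  The
half-edges are the pairs `(v, i)` with `v` a trinode and `i : Fin 3`, together with one half-edge
for every leaf; `attach` sends a half-edge to its edge, and every edge has exactly two
half-edges. -/
structure TrivalentGraph where
  V : Type
  E : Type
  Leaf : Type
  finite_V : Finite V
  finite_E : Finite E
  finite_Leaf : Finite Leaf
  attach : (V × Fin 3) ⊕ Leaf → E
  two_ends : ∀ e, ∃ h k, h ≠ k ∧ ∀ x, attach x = e ↔ x = h ∨ x = k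

namespace TrivalentGraph

/-- The half-edges of a trivalent graph. -/
abbrev HalfEdge (Γ : TrivalentGraph) : Type := (Γ.V × Fin 3) ⊕ Γ.Leaf

/-- The vertex at which a half-edge is based. -/
def base (Γ : TrivalentGraph) : Γ.HalfEdge → Γ.V ⊕ Γ.Leaf := Sum.map Prod.fst id

/-- The `i`-th edge at the trinode `v`. -/
abbrev edgeAt (Γ : TrivalentGraph) (v : Γ.V) (i : Fin 3) : Γ.E := Γ.attach (Sum.inl (v, i))

/-- The edge attached to a leaf. -/
abbrev leafEdge (Γ : TrivalentGraph) (l : Γ.Leaf) : Γ.E := Γ.attach (Sum.inr l)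

/-- The simple graph on all vertices of `Γ` in which two distinct vertices are adjacent if some
edge of `Γ` outside of `S` joins them. -/
def deleteEdges (Γ : TrivalentGraph) (S : Set Γ.E) : SimpleGraph (Γ.V ⊕ Γ.Leaf) :=
  SimpleGraph.fromRel fun x y =>
    ∃ h k : Γ.HalfEdge, Γ.attach h = Γ.attach k ∧ Γ.attach h ∉ S ∧ Γ.base h = x ∧ Γ.base k = y

/-- The graph is connected (and non-empty). -/
def IsConnected (Γ : TrivalentGraph) : Prop := (Γ.deleteEdges ∅).Connected

/-- Removing the (open) edge `e` disconnects the graph. -/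
def IsSeparating (Γ : TrivalentGraph) (e : Γ.E) : Prop := ¬ (Γ.deleteEdges {e}).Connected

/-- A trivalent tree: a connected trivalent graph without cycles, that is, each of whose edges is
separating. -/
def IsTree (Γ : TrivalentGraph) : Prop := Γ.IsConnected ∧ ∀ e, Γ.IsSeparating e

/-- The trinode `v` is connected by an edge to some leaf. -/
def HasLeaf (Γ : TrivalentGraph) (v : Γ.V) : Prop :=
  ∃ (i : Fin 3) (l : Γ.Leaf), Γ.edgeAt v i = Γ.leafEdge l

/-- A caterpillar tree: a trivalent tree in which every trinode is connected by an edge to a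
leaf. -/
def IsCaterpillarTree (Γ : TrivalentGraph) : Prop := Γ.IsTree ∧ ∀ v, Γ.HasLeaf v

/-- Attach a loop at the leaf `l`: the leaf becomes a trinode (called `none`), whose three
half-edges are the end of the old leaf edge and the two ends of a new edge (called `none`). -/
def addLoop (Γ : TrivalentGraph) (l : Γ.Leaf) : TrivalentGraph where
  V := Option Γ.V
  E := Option Γ.E
  Leaf := {m : Γ.Leaf // m ≠ l}
  finite_V := by have := Γ.finite_V; infer_instance
  finite_E := by have := Γ.finite_E; infer_instance
  finite_Leaf := by have := Γ.finite_Leaf; infer_instance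
  attach
    | Sum.inl (some v, i) => some (Γ.edgeAt v i)
    | Sum.inl (none, 0) => some (Γ.leafEdge l)
    | Sum.inl (none, _) => none
    | Sum.inr m => some (Γ.leafEdge m.1)
  two_ends := by
    rintro (_ | e)
    · refine ⟨Sum.inl (none, 1), Sum.inl (none, 2), by simp, ?_⟩
      rintro (⟨_ | v, i⟩ | m)
      · fin_cases i <;> simp
      · simp
      · simp
    · classical
      obtain ⟨h, k, hk, H⟩ := Γ.two_ends e
      let f : Γ.HalfEdge → (Option Γ.V × Fin 3) ⊕ {m : Γ.Leaf // m ≠ l} := fun x =>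
        match x with
        | Sum.inl (v, i) => Sum.inl (some v, i)
        | Sum.inr m => if hm : m = l then Sum.inl (none, 0) else Sum.inr ⟨m, hm⟩
      have f1 : ∀ v i, f (Sum.inl (v, i)) = Sum.inl (some v, i) := fun _ _ => rfl
      have f2 : f (Sum.inr l) = Sum.inl (none, 0) := by simp [f]
      have f3 : ∀ m : {m : Γ.Leaf // m ≠ l}, f (Sum.inr m.1) = Sum.inr m := by
        rintro ⟨m, hm⟩; simp [f, hm]
      have fi : Function.Injective f := by
        rintro (⟨v, i⟩ | m) (⟨w, j⟩ | n) hx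
        · simpa [f] using hx
        · simp only [f] at hx; split_ifs at hx; simp at hx
        · simp only [f] at hx; split_ifs at hx; simp at hx
        · simp only [f] at hx; split_ifs at hx <;> simp_all
      have key : ∀ x, some (Γ.attach x) = some e ↔ f x = f h ∨ f x = f k := fun x => by
        rw [fi.eq_iff, fi.eq_iff, Option.some_inj, H]
      refine ⟨f h, f k, fi.ne hk, ?_⟩
      rintro (⟨_ | v, i⟩ | m)
      · fin_cases i
        · have := key (Sum.inr l)
          rw [f2] at this
          exact this
        all_goals
          constructor
          · intro hx; simp at hx
          · intro hx
            exfalso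
            rcases hx with hx | hx
            · rcases h with ⟨v, i⟩ | m
              · simp [f] at hx
              · simp only [f] at hx; split_ifs at hx; simp at hx
            · rcases k with ⟨v, i⟩ | m
              · simp [f] at hx
              · simp only [f] at hx; split_ifs at hx; simp at hx
      · exact key (Sum.inl (v, i))
      · have := key (Sum.inr m.1)
        rw [f3] at this
        exact this

open Classical in
/-- Insert a doubled edge into the interior of the edge `e` that contains the half-edge `h`.  The
edge `e` is cut into two pieces (called `e` and `0`, the latter being the one that keeps the
half-edge `h`), each of which ends at a new trinode (`false` and `true`, respectively), and the two
new trinodes are joined by two new edges (called `1` and `2`). -/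
noncomputable def addDoubledEdge (Γ : TrivalentGraph) (h : Γ.HalfEdge) : TrivalentGraph where
  V := Γ.V ⊕ Bool
  E := Γ.E ⊕ Fin 3
  Leaf := Γ.Leaf
  finite_V := by have := Γ.finite_V; infer_instance
  finite_E := by have := Γ.finite_E; infer_instance
  finite_Leaf := Γ.finite_Leaf
  attach
    | Sum.inl (Sum.inl v, i) =>
        if Sum.inl (v, i) = h then Sum.inr 0 else Sum.inl (Γ.edgeAt v i)
    | Sum.inr l => if Sum.inr l = h then Sum.inr 0 else Sum.inl (Γ.leafEdge l)
    | Sum.inl (Sum.inr false, 0) => Sum.inl (Γ.attach h)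
    | Sum.inl (Sum.inr _, i) => Sum.inr i
  two_ends := by
    let f : Γ.HalfEdge → ((Γ.V ⊕ Bool) × Fin 3) ⊕ Γ.Leaf :=
      Sum.map (Prod.map Sum.inl id) id
    have fi : Function.Injective f :=
      (Sum.inl_injective.prodMap Function.injective_id).sumMap Function.injective_id
    have f1 : ∀ v i, Sum.inl (Sum.inl v, i) = f (Sum.inl (v, i)) := fun _ _ => rfl
    have f2 : ∀ l, Sum.inr l = f (Sum.inr l) := fun _ => rfl
    have f3 : ∀ b i x, Sum.inl (Sum.inr b, i) ≠ f x := by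
      rintro b i (⟨v, j⟩ | l) <;> simp [f]
    rintro (e | j)
    · by_cases he : Γ.attach h = e
      · obtain ⟨k, hk, H⟩ : ∃ k, h ≠ k ∧ ∀ x, Γ.attach x = e ↔ x = h ∨ x = k := by
          obtain ⟨a, b, hab, H⟩ := Γ.two_ends e
          rcases (H h).1 he with rfl | rfl
          · exact ⟨b, hab, H⟩
          · exact ⟨a, hab.symm, fun x => by rw [H, or_comm]⟩
        refine ⟨Sum.inl (Sum.inr false, 0), f k, f3 _ _ _, ?_⟩
        have key : ∀ x, (if x = h then Sum.inr 0 else Sum.inl (Γ.attach x) : Γ.E ⊕ Fin 3)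
            = Sum.inl e ↔ x = k := by
          intro x
          split_ifs with hx
          · subst hx; simpa using hk
          · simp [H, hx]
        rintro (⟨v | b, i⟩ | l)
        · refine (key _).trans ?_
          rw [f1, fi.eq_iff]; simp [(f3 _ _ _).symm]
        · rcases b <;> fin_cases i <;> simp [f3, he]
        · refine (key _).trans ?_
          rw [f2, fi.eq_iff]; simp [(f3 _ _ _).symm]
      · obtain ⟨a, b, hab, H⟩ := Γ.two_ends e
        refine ⟨f a, f b, fi.ne hab, ?_⟩
        have key : ∀ x, (if x = h then Sum.inr 0 else Sum.inl (Γ.attach x) : Γ.E ⊕ Fin 3)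
            = Sum.inl e ↔ x = a ∨ x = b := by
          intro x
          split_ifs with hx
          · subst hx; rw [← H]; simpa using he
          · simp [H]
        rintro (⟨v | c, i⟩ | l)
        · refine (key _).trans ?_
          rw [f1, fi.eq_iff, fi.eq_iff]
        · rcases c <;> fin_cases i <;> simp [f3, he]
        · refine (key _).trans ?_
          rw [f2, fi.eq_iff, fi.eq_iff]
    · have key : ∀ x, (if x = h then Sum.inr 0 else Sum.inl (Γ.attach x) : Γ.E ⊕ Fin 3)
          = Sum.inr j ↔ j = 0 ∧ x = h := by
        intro x
        split_ifs with hx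
        · simp [hx, eq_comm]
        · simp [hx]
      by_cases hj : j = 0
      · subst hj
        refine ⟨Sum.inl (Sum.inr true, 0), f h, f3 _ _ _, ?_⟩
        rintro (⟨v | c, i⟩ | l)
        · refine (key _).trans ?_
          rw [f1, fi.eq_iff]; simp [(f3 _ _ _).symm]
        · rcases c <;> fin_cases i <;> simp [f3]
        · refine (key _).trans ?_
          rw [f2, fi.eq_iff]; simp [(f3 _ _ _).symm]
      · refine ⟨Sum.inl (Sum.inr true, j), Sum.inl (Sum.inr false, j), by simp, ?_⟩
        rintro (⟨v | c, i⟩ | l)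
        · refine (key _).trans ?_
          simp [hj]
        · fin_cases j
          · simp at hj
          all_goals rcases c <;> fin_cases i <;> simp
        · refine (key _).trans ?_
          simp [hj]

/-- Two trivalent graphs are isomorphic: there are bijections between the trinodes, the edges and
the leaves that respect the incidences (the numbering of the half-edges at a trinode is
irrelevant). -/
def IsIsomorphic (Γ Γ' : TrivalentGraph) : Prop :=
  ∃ (a : Γ.V ≃ Γ'.V) (b : Γ.E ≃ Γ'.E) (c : Γ.Leaf ≃ Γ'.Leaf),
    (∀ l, Γ'.leafEdge (c l) = b (Γ.leafEdge l)) ∧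
    ∀ v, ∃ s : Equiv.Perm (Fin 3), ∀ i, Γ'.edgeAt (a v) (s i) = b (Γ.edgeAt v i)

/-- `ObtainedFrom T Γ ι`: the graph `Γ` arises from `T` by finitely many steps, each of which
attaches a loop at a leaf or inserts a doubled edge into a separating edge; `ι` sends a trinode of
`T` to the same trinode in `Γ`. -/
inductive ObtainedFrom (T : TrivalentGraph) : (Γ : TrivalentGraph) → (T.V → Γ.V) → Prop
  | refl : ObtainedFrom T T id
  | loop {Γ : TrivalentGraph} {ι : T.V → Γ.V} (l : Γ.Leaf) :
      ObtainedFrom T Γ ι → ObtainedFrom T (Γ.addLoop l) fun v => some (ι v)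
  | doubledEdge {Γ : TrivalentGraph} {ι : T.V → Γ.V} (h : Γ.HalfEdge) :
      Γ.IsSeparating (Γ.attach h) → ObtainedFrom T Γ ι →
        ObtainedFrom T (Γ.addDoubledEdge h) fun v => Sum.inl (ι v)

/-- A caterpillar graph is obtained from a caterpillar tree by attaching loops at leaves and
inserting doubled edges into separating edges, in such a way that every trinode of the tree is
still connected by an edge to a leaf (so loops occur only at the head or the tail, at most one at
each, and the leaf edges along the body are not subdivided). -/
def IsCaterpillarGraph (Γ : TrivalentGraph) : Prop :=
  ∃ (T Γ' : TrivalentGraph) (ι : T.V → Γ'.V), T.IsCaterpillarTree ∧ ObtainedFrom T Γ' ι ∧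
    (∀ v, Γ'.HasLeaf (ι v)) ∧ Γ'.IsIsomorphic Γ

/-- The polytope `P_Γ(r, L)` of non-negative real edge weightings. -/
def polytope (Γ : TrivalentGraph) (r : Γ.Leaf → ℕ) (L : ℕ) : Set (Γ.E → ℝ) :=
  {w | (∀ e, 0 ≤ w e) ∧
    (∀ v, |w (Γ.edgeAt v 0) - w (Γ.edgeAt v 1)| ≤ w (Γ.edgeAt v 2) ∧
      w (Γ.edgeAt v 2) ≤ w (Γ.edgeAt v 0) + w (Γ.edgeAt v 1)) ∧
    (∀ v, w (Γ.edgeAt v 0) + w (Γ.edgeAt v 1) + w (Γ.edgeAt v 2) ≤ 2 * (L : ℝ)) ∧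
    ∀ l, w (Γ.leafEdge l) = r l}

/-- The lattice of integer edge weightings whose sum at every trinode is even. -/
def lattice (Γ : TrivalentGraph) : AddSubgroup (Γ.E → ℝ) where
  carrier := {w | (∀ e, ∃ k : ℤ, w e = k) ∧
    ∀ v, ∃ k : ℤ, w (Γ.edgeAt v 0) + w (Γ.edgeAt v 1) + w (Γ.edgeAt v 2) = 2 * (k : ℝ)}
  zero_mem' := ⟨fun _ => ⟨0, by simp⟩, fun _ => ⟨0, by simp⟩⟩
  add_mem' := by
    rintro x y ⟨hx, hx'⟩ ⟨hy, hy'⟩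
    refine ⟨fun e => ?_, fun v => ?_⟩
    · obtain ⟨a, ha⟩ := hx e
      obtain ⟨b, hb⟩ := hy e
      exact ⟨a + b, by simp [ha, hb]⟩
    · obtain ⟨a, ha⟩ := hx' v
      obtain ⟨b, hb⟩ := hy' v
      refine ⟨a + b, ?_⟩
      simp only [Pi.add_apply]
      push_cast
      linarith
  neg_mem' := by
    rintro x ⟨hx, hx'⟩
    refine ⟨fun e => ?_, fun v => ?_⟩
    · obtain ⟨a, ha⟩ := hx e
      exact ⟨-a, by simp [ha]⟩
    · obtain ⟨a, ha⟩ := hx' v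
      refine ⟨-a, ?_⟩
      simp only [Pi.neg_apply]
      push_cast
      linarith

end TrivalentGraph

namespace LatticePolytope

/-- The `m`-fold Minkowski sum `P + ⋯ + P`. -/
def minkowskiSum {ι : Type} (P : Set (ι → ℝ)) (m : ℕ) : Set (ι → ℝ) :=
  {x | ∃ p : Fin m → ι → ℝ, (∀ i, p i ∈ P) ∧ x = ∑ i, p i}

/-- The graded semigroup of `P` with respect to the lattice `M`: its elements of degree `m` are the
points of `M` in the `m`-fold Minkowski sum of `P`. -/
def gradedSemigroup {ι : Type} (M : AddSubgroup (ι → ℝ)) (P : Set (ι → ℝ)) :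
    AddSubmonoid (ℕ × (ι → ℝ)) where
  carrier := {s | s.2 ∈ M ∧ s.2 ∈ minkowskiSum P s.1}
  zero_mem' := ⟨M.zero_mem, Fin.elim0, fun i => i.elim0, by simp⟩
  add_mem' := by
    rintro ⟨m, x⟩ ⟨n, y⟩ ⟨hx, p, hp, hpx⟩ ⟨hy, q, hq, hqy⟩
    refine ⟨M.add_mem hx hy, Fin.append p q, fun i => ?_, ?_⟩
    · refine Fin.addCases (fun j => ?_) (fun j => ?_) i
      · simpa using hp j
      · simpa using hq j
    · change x + y = _
      have hx' : x = ∑ i, p i := hpx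
      have hy' : y = ∑ i, q i := hqy
      change _ = ∑ i : Fin (m + n), Fin.append p q i
      rw [Fin.sum_univ_add, hx', hy']
      simp

/-- The graded algebra `ℂ[P]`. -/
abbrev toricAlgebra {ι : Type} (M : AddSubgroup (ι → ℝ)) (P : Set (ι → ℝ)) : Type :=
  AddMonoidAlgebra ℂ (gradedSemigroup M P)

/-- `ℂ[P]` is generated as a `ℂ`-algebra by its elements of degree `1`. -/
def GeneratedInDegreeOne {ι : Type} (M : AddSubgroup (ι → ℝ)) (P : Set (ι → ℝ)) : Prop :=
  Algebra.adjoin ℂ {f : toricAlgebra M P |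
    ∃ s : gradedSemigroup M P, s.1.1 = 1 ∧ f = AddMonoidAlgebra.single s 1} = ⊤

/-- The set `X_P` of lattice points of `P`. -/
abbrev latticePoints {ι : Type} (M : AddSubgroup (ι → ℝ)) (P : Set (ι → ℝ)) : Type :=
  {x : ι → ℝ // x ∈ M ∧ x ∈ P}

/-- A lattice point of `P` as an element of degree `1` of the graded semigroup. -/
def degreeOne {ι : Type} {M : AddSubgroup (ι → ℝ)} {P : Set (ι → ℝ)} (x : latticePoints M P) :
    gradedSemigroup M P :=
  ⟨(1, x.1), x.2.1, fun _ => x.1, fun _ => x.2.2, by simp⟩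

/-- The map `ℂ[X_P] → ℂ[P]` that sends the variable of a lattice point to that lattice point. -/
noncomputable def presentation {ι : Type} (M : AddSubgroup (ι → ℝ)) (P : Set (ι → ℝ)) :
    MvPolynomial (latticePoints M P) ℂ →ₐ[ℂ] toricAlgebra M P :=
  MvPolynomial.aeval fun x => AddMonoidAlgebra.single (degreeOne x) 1

/-- The presenting toric ideal `I_P`, the kernel of `ℂ[X_P] → ℂ[P]`. -/
noncomputable def toricIdeal {ι : Type} (M : AddSubgroup (ι → ℝ)) (P : Set (ι → ℝ)) :
    Ideal (MvPolynomial (latticePoints M P) ℂ) :=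
  RingHom.ker (presentation M P)

end LatticePolytope

/-- `G` is a Gröbner basis of the ideal `I` with respect to the monomial order `m`. -/
def IsGroebnerBasis {σ : Type} (m : MonomialOrder.{0, 0} σ) (I : Ideal (MvPolynomial σ ℂ))
    (G : Set (MvPolynomial σ ℂ)) : Prop :=
  G.Finite ∧ G ⊆ (I : Set (MvPolynomial σ ℂ)) ∧
    Ideal.span (m.leadingTerm '' G) =
      Ideal.span (m.leadingTerm '' (I : Set (MvPolynomial σ ℂ)))

/-- For some monomial order, `I` has a Gröbner basis that consists of homogeneous polynomials of
degree `2` with square-free leading monomials. -/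
def HasQuadraticSquarefreeGroebnerBasis {σ : Type} (I : Ideal (MvPolynomial σ ℂ)) : Prop :=
  ∃ (m : MonomialOrder.{0, 0} σ) (G : Set (MvPolynomial σ ℂ)), IsGroebnerBasis m I G ∧
    ∀ g ∈ G, g ≠ 0 ∧ g.IsHomogeneous 2 ∧ ∀ x, m.degree g x ≤ 1

/-!
The polytope becomes, in suitable integral coordinates, an alcoved polytope of type `C`, and such
polytopes have a regular, unimodular and flag triangulation.

*Coordinates.*  A lattice point with even leaf weights is even at every separating edge: add up the
weights on one side of the edge (`TrivalentGraph.HasCut.even`).  Halving the weights of the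
separating edges, and replacing the two weights of a doubled edge by their half sum and half
difference, identifies the lattice points with even leaf weights with vectors of `ℤ ^ E`
(`TrivalentGraph.coordMap`).  As every trinode of the tree meets a leaf edge, whose weight is fixed,
and every other trinode meets a loop or a doubled edge, each inequality at a trinode bounds `± z i`
or `± z i ± z j` by an integer `c`.  Moreover there are parities `ε` of the coordinates such that
`c ≡ ε i + ε j` modulo `2` in the second case
(`TrivalentGraph.IsCaterpillarShape.exists_parity`): separating edges allow changing the parities at
one trinode of the tree without affecting the other trinodes.

*Rounding.*  For a point `z` of the `m`-fold dilate, let `x i` be `z i / m` if this is an integer,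
and otherwise the neighbouring integer of the parity of `ε i` (`IsRounding`).  Inequalities of the
above form are inherited by `x` and, with `m - 1` in place of `m`, by `z - x`
(`IsRounding.add_le`).  By induction, `z` is a sum of `m` lattice points of the polytope, so that the
algebra is generated in degree one.  For `m = 2`, two lattice points `x`, `y` may be replaced by the
rounding of their midpoint and the complementary point.

*Gröbner basis.*  This exchange strictly decreases a height function (`alcoveHeight_lt`) unless `x`
and `y` are comparable in a certain partial order (`AlcoveLE`), that is, lie in a common alcove.  A
monomial without incomparable pairs is a chain, and a chain is determined by its length and its sum,
because its least element is the rounding of its barycentre (`chain_unique`).  Hence the exchange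
binomials form a Gröbner basis for the monomial order given by the height
(`hasQuadraticSquarefreeGroebnerBasis_of_exchange`), and their leading monomials are products of two
different variables.
-/

/-! ### Monomial orders given by weights -/

/-- The exponent vectors of monomials, as a type synonym that carries the order by weights, with ties
broken lexicographically. -/
def WeightSyn {σ : Type} (_ : σ → ℕ) : Type := σ →₀ ℕ

namespace WeightSyn

variable {σ : Type} (w : σ → ℕ)

noncomputable instance : AddCommMonoid (WeightSyn w) := inferInstanceAs (AddCommMonoid (σ →₀ ℕ))

/-- The weight of an exponent vector, paired with its position in the lexicographic order. -/
noncomputable def key (d : WeightSyn w) : ℕ ×ₗ Lex (σ →₀ ℕ) :=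
  toLex (Finsupp.linearCombination ℕ w d, toLex d)

theorem key_injective : Function.Injective (key w) := by
  intro a b h
  have := congrArg (fun z => ofLex (ofLex z).2) h
  exact this

variable [LinearOrder σ]

noncomputable instance : LinearOrder (WeightSyn w) := LinearOrder.lift' (key w) (key_injective w)

theorem le_iff (a b : WeightSyn w) : a ≤ b ↔ key w a ≤ key w b := Iff.rfl

instance : IsOrderedAddMonoid (WeightSyn w) where
  add_le_add_left a b h c := by
    rw [le_iff, key, key, Prod.Lex.toLex_le_toLex] at h ⊢
    have e : ∀ x y : σ →₀ ℕ, Finsupp.linearCombination ℕ w (x + y)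
      = Finsupp.linearCombination ℕ w x + Finsupp.linearCombination ℕ w y := fun x y => map_add _ x y
    have ea : Finsupp.linearCombination ℕ w (a + c)
      = Finsupp.linearCombination ℕ w a + Finsupp.linearCombination ℕ w c := e a c
    have eb : Finsupp.linearCombination ℕ w (b + c)
      = Finsupp.linearCombination ℕ w b + Finsupp.linearCombination ℕ w c := e b c
    simp only at h ⊢
    rw [ea, eb]
    rcases h with h | ⟨h, h'⟩
    · left; omega
    · right
      refine ⟨by omega, ?_⟩
      exact add_le_add_left (α := Lex (σ →₀ ℕ)) h' (toLex c)

instance [WellFoundedGT σ] : WellFoundedLT (WeightSyn w) :=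
  ⟨InvImage.wf (key w) wellFounded_lt⟩

end WeightSyn

/-- The monomial order that compares weights first and breaks ties lexicographically. -/
noncomputable def MonomialOrder.weighted {σ : Type} [LinearOrder σ] [WellFoundedGT σ]
    (w : σ → ℕ) : MonomialOrder.{0, 0} σ where
  syn := WeightSyn w
  toSyn := { toEquiv := Equiv.refl (σ →₀ ℕ), map_add' := fun _ _ => rfl }
  toSyn_monotone a b h := by
    rw [WeightSyn.le_iff, WeightSyn.key, WeightSyn.key, Prod.Lex.toLex_le_toLex]
    obtain ⟨c, rfl⟩ := exists_add_of_le h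
    have e : Finsupp.linearCombination ℕ w (a + c)
      = Finsupp.linearCombination ℕ w a + Finsupp.linearCombination ℕ w c := map_add _ a c
    rcases Nat.eq_zero_or_pos (Finsupp.linearCombination ℕ w c) with h0 | h0
    · right
      refine ⟨?_, Finsupp.toLex_monotone h⟩
      change Finsupp.linearCombination ℕ w a = Finsupp.linearCombination ℕ w (a + c)
      omega
    · left
      change Finsupp.linearCombination ℕ w a < Finsupp.linearCombination ℕ w (a + c)
      omega

theorem MonomialOrder.weighted_lt {σ : Type} [LinearOrder σ] [WellFoundedGT σ] (w : σ → ℕ)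
    {a b : σ →₀ ℕ} (h : Finsupp.linearCombination ℕ w a < Finsupp.linearCombination ℕ w b) :
    (MonomialOrder.weighted w).toSyn a < (MonomialOrder.weighted w).toSyn b := by
  refine lt_of_not_ge fun h' => ?_
  have h2 : WeightSyn.key w b ≤ WeightSyn.key w a := h'
  rcases Prod.Lex.toLex_le_toLex.1 h2 with h3 | ⟨h3, -⟩
  · exact h3.not_gt h
  · exact h3.not_gt h

/-- The variables need not be ordered in advance: any enumeration of them can break the ties. -/
theorem MonomialOrder.exists_weighted {σ : Type} [Finite σ] (w : σ → ℕ) :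
    ∃ m : MonomialOrder.{0, 0} σ, ∀ a b : σ →₀ ℕ,
      Finsupp.linearCombination ℕ w a < Finsupp.linearCombination ℕ w b →
      m.toSyn a < m.toSyn b := by
  obtain ⟨n, ⟨f⟩⟩ := Finite.exists_equiv_fin σ
  let _ : LinearOrder σ := LinearOrder.lift' f f.injective
  exact ⟨MonomialOrder.weighted w, fun _ _ h => MonomialOrder.weighted_lt w h⟩

/-! ### Gröbner bases of toric ideals from exchanges of pairs -/

section ToricKernel

open MvPolynomial

variable {σ S : Type} [AddCommMonoid S] (a : σ → S)

/-- The degree of a monomial in the monoid grading in which the variable `x` has degree `a x`. -/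
noncomputable def monoidDegree : (σ →₀ ℕ) →+ S :=
  (Multiset.sumAddMonoidHom.comp (Multiset.mapAddMonoidHom a)).comp
    Finsupp.toMultiset

theorem monoidDegree_single (x : σ) : monoidDegree a (Finsupp.single x 1) = a x := by
  simp [monoidDegree]

theorem aeval_single_monomial (d : σ →₀ ℕ) (c : ℂ) :
    aeval (fun x => (AddMonoidAlgebra.single (a x) 1 : AddMonoidAlgebra ℂ S)) (monomial d c)
      = AddMonoidAlgebra.single (monoidDegree a d) c := by
  have h1 : aeval (fun x => (AddMonoidAlgebra.single (a x) 1 : AddMonoidAlgebra ℂ S))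
      (monomial d (1 : ℂ)) = AddMonoidAlgebra.single (monoidDegree a d) 1 := by
    induction d using Finsupp.induction_linear with
    | zero => rw [monomial_zero', C_1, map_one, map_zero]; rfl
    | add d e hd he =>
      rw [show monomial (d + e) (1 : ℂ) = monomial d 1 * monomial e 1 by simp [monomial_mul],
        map_mul, hd, he, AddMonoidAlgebra.single_mul_single, map_add, one_mul]
    | single x n =>
      induction n with
      | zero => rw [Finsupp.single_zero, monomial_zero', C_1, map_one, map_zero]; rfl
      | succ n ih =>
        rw [Finsupp.single_add, show monomial (Finsupp.single x n + Finsupp.single x 1) (1 : ℂ)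
          = monomial (Finsupp.single x n) 1 * X x by simp [monomial_mul, X],
          map_mul, ih, aeval_X, AddMonoidAlgebra.single_mul_single, map_add, one_mul,
          monoidDegree_single]
  rw [show monomial d c = c • monomial d (1 : ℂ) by simp [smul_monomial], map_smul, h1]
  simp

/-- A polynomial in the kernel of `X x ↦ single (a x) 1` has no isolated term: in each monoid
degree its coefficients sum to zero. -/
theorem exists_ne_mem_support_of_mem_ker {f : MvPolynomial σ ℂ}
    (hf : aeval (fun x => (AddMonoidAlgebra.single (a x) 1 : AddMonoidAlgebra ℂ S)) f = 0)
    {d : σ →₀ ℕ} (hd : d ∈ f.support) :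
    ∃ e ∈ f.support, e ≠ d ∧ monoidDegree a e = monoidDegree a d := by
  classical
  by_contra! H
  have h1 := hf
  rw [← f.support_sum_monomial_coeff, map_sum] at h1
  simp only [aeval_single_monomial] at h1
  have h2 := congrArg (fun g : AddMonoidAlgebra ℂ S => g.coeff (monoidDegree a d)) h1
  simp only [AddMonoidAlgebra.coeff_sum, Finsupp.finsetSum_apply, AddMonoidAlgebra.coeff_single,
    AddMonoidAlgebra.coeff_zero, Finsupp.coe_zero, Pi.zero_apply] at h2
  rw [Finset.sum_eq_single d] at h2
  · rw [Finsupp.single_eq_same] at h2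
    exact (mem_support_iff.1 hd) h2
  · intro e he hne
    exact Finsupp.single_eq_of_ne (H e he hne).symm
  · intro h; exact absurd hd h

/-- The exponent vector of the product of two variables. -/
noncomputable def pairExp (x y : σ) : σ →₀ ℕ := Finsupp.single x 1 + Finsupp.single y 1

theorem monoidDegree_pairExp (x y : σ) : monoidDegree a (pairExp x y) = a x + a y := by
  simp only [pairExp, map_add, monoidDegree_single]

theorem pairExp_le {x y : σ} (hne : x ≠ y) {d : σ →₀ ℕ} (hx : x ∈ d.support)
    (hy : y ∈ d.support) : pairExp x y ≤ d := by
  classical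
  intro z
  rw [Finsupp.mem_support_iff] at hx hy
  simp only [pairExp, Finsupp.add_apply, Finsupp.single_apply]
  split_ifs with h1 h2 h2
  · exact absurd (h1.trans h2.symm) hne
  · subst h1; omega
  · subst h2; omega
  · omega

theorem pairExp_le_one {x y : σ} (hne : x ≠ y) (z : σ) : pairExp x y z ≤ 1 := by
  classical
  simp only [pairExp, Finsupp.add_apply, Finsupp.single_apply]
  split_ifs with h1 h2 h2
  · exact absurd (h1.trans h2.symm) hne
  all_goals omega

/-- The difference of two quadratic monomials. -/
noncomputable def quadricBinomial (q : σ × σ × σ × σ) : MvPolynomial σ ℂ :=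
  monomial (pairExp q.1 q.2.1) 1 - monomial (pairExp q.2.2.1 q.2.2.2) 1

section Order

variable (m : MonomialOrder.{0, 0} σ)

theorem degree_quadricBinomial {x y x' y' : σ}
    (h : m.toSyn (pairExp x' y') < m.toSyn (pairExp x y)) :
    m.degree (quadricBinomial (x, y, x', y')) = pairExp x y := by
  classical
  have deg_mon : ∀ d, m.degree (monomial d (1 : ℂ)) = d := fun d => by
    rw [MonomialOrder.degree_monomial]; simp
  rw [quadricBinomial, MonomialOrder.degree_sub_of_lt, deg_mon]
  rw [deg_mon, deg_mon]
  exact h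

theorem leadingTerm_quadricBinomial {x y x' y' : σ}
    (h : m.toSyn (pairExp x' y') < m.toSyn (pairExp x y)) :
    m.leadingTerm (quadricBinomial (x, y, x', y')) = monomial (pairExp x y) 1 := by
  classical
  have deg_mon : ∀ d, m.degree (monomial d (1 : ℂ)) = d := fun d => by
    rw [MonomialOrder.degree_monomial]; simp
  rw [MonomialOrder.leadingTerm, degree_quadricBinomial m h]
  congr 1
  rw [quadricBinomial, MonomialOrder.leadingCoeff_sub_of_lt]
  · simp
  · rw [deg_mon, deg_mon]; exact h

variable {a m} {Bad : σ → σ → Prop}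

/-- A monomial in which no bad pair occurs is the smallest one of its monoid degree. -/
theorem toSyn_le_of_forall_not_bad (bad_ne : ∀ x y, Bad x y → x ≠ y)
    (exchange : ∀ x y, Bad x y → ∃ x' y', a x + a y = a x' + a y' ∧
      m.toSyn (pairExp x' y') < m.toSyn (pairExp x y))
    (unique : ∀ d e : σ →₀ ℕ, (∀ x ∈ d.support, ∀ y ∈ d.support, ¬ Bad x y) →
      (∀ x ∈ e.support, ∀ y ∈ e.support, ¬ Bad x y) → monoidDegree a d = monoidDegree a e →
      d = e)
    (d : σ →₀ ℕ) (hd : ∀ x ∈ d.support, ∀ y ∈ d.support, ¬ Bad x y) (e : m.syn)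
    (he : monoidDegree a (m.toSyn.symm e) = monoidDegree a d) : m.toSyn d ≤ e := by
  induction e using WellFoundedLT.induction with
  | ind e ih =>
    by_cases hg : ∀ x ∈ (m.toSyn.symm e).support, ∀ y ∈ (m.toSyn.symm e).support, ¬ Bad x y
    · rw [unique _ _ hd hg he.symm, AddEquiv.apply_symm_apply]
    · push Not at hg
      obtain ⟨x, hx, y, hy, hb⟩ := hg
      obtain ⟨x', y', hs, hw⟩ := exchange x y hb
      obtain ⟨c, hc⟩ := exists_add_of_le (pairExp_le (bad_ne x y hb) hx hy)
      have hlt : m.toSyn (pairExp x' y' + c) < e := by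
        have : e = m.toSyn (pairExp x y + c) := by rw [← hc, AddEquiv.apply_symm_apply]
        rw [this, map_add, map_add]
        exact add_lt_add_left hw _
      refine (ih _ hlt ?_).trans hlt.le
      rw [AddEquiv.symm_apply_apply, ← he, hc, map_add, map_add, monoidDegree_pairExp,
        monoidDegree_pairExp, hs]

/-- If every bad pair of variables can be replaced by a smaller pair of the same monoid degree, and
if a monomial without bad pairs is determined by its monoid degree, then the kernel has a quadratic
square-free Gröbner basis. -/
theorem hasQuadraticSquarefreeGroebnerBasis_of_exchange [Finite σ]
    (bad_ne : ∀ x y, Bad x y → x ≠ y)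
    (exchange : ∀ x y, Bad x y → ∃ x' y', a x + a y = a x' + a y' ∧
      m.toSyn (pairExp x' y') < m.toSyn (pairExp x y))
    (unique : ∀ d e : σ →₀ ℕ, (∀ x ∈ d.support, ∀ y ∈ d.support, ¬ Bad x y) →
      (∀ x ∈ e.support, ∀ y ∈ e.support, ¬ Bad x y) → monoidDegree a d = monoidDegree a e →
      d = e) :
    HasQuadraticSquarefreeGroebnerBasis (RingHom.ker
      (aeval fun x => (AddMonoidAlgebra.single (a x) 1 : AddMonoidAlgebra ℂ S))) := by
  let G : Set (MvPolynomial σ ℂ) := quadricBinomial '' {q | Bad q.1 q.2.1 ∧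
    a q.1 + a q.2.1 = a q.2.2.1 + a q.2.2.2 ∧
    m.toSyn (pairExp q.2.2.1 q.2.2.2) < m.toSyn (pairExp q.1 q.2.1)}
  have G_sub : G ⊆ ((RingHom.ker
      (aeval fun x => (AddMonoidAlgebra.single (a x) 1 : AddMonoidAlgebra ℂ S)) :
      Ideal (MvPolynomial σ ℂ)) : Set (MvPolynomial σ ℂ)) := by
    rintro _ ⟨⟨x, y, x', y'⟩, ⟨-, hs, -⟩, rfl⟩
    have h1 := aeval_single_monomial a (pairExp x y) 1
    have h2 := aeval_single_monomial a (pairExp x' y') 1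
    rw [monoidDegree_pairExp] at h1 h2
    change aeval _ (_ - _) = 0
    rw [map_sub, h1, h2]
    exact sub_eq_zero.2 (congrArg (fun s => AddMonoidAlgebra.single s (1 : ℂ)) hs)
  refine ⟨m, G, ⟨(Set.toFinite _).image _, G_sub,
    le_antisymm (Ideal.span_mono (Set.image_mono G_sub)) ?_⟩, ?_⟩
  · rw [Ideal.span_le]
    rintro _ ⟨f, hf, rfl⟩
    by_cases hf0 : f = 0
    · simp [hf0]
    have hd := MonomialOrder.degree_mem_support (m := m) hf0
    obtain ⟨e, he, hne, hde⟩ := exists_ne_mem_support_of_mem_ker a hf hd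
    -- otherwise the leading monomial would be the smallest one of its monoid degree
    have hex : ∃ x ∈ (m.degree f).support, ∃ y ∈ (m.degree f).support, Bad x y := by
      by_contra! H
      have h1 := toSyn_le_of_forall_not_bad bad_ne exchange unique _ H (m.toSyn e)
        (by rw [AddEquiv.symm_apply_apply, hde])
      exact hne (m.toSyn.injective (le_antisymm (m.le_degree he) h1))
    obtain ⟨x, hx, y, hy, hb⟩ := hex
    obtain ⟨x', y', hs, hw⟩ := exchange x y hb
    obtain ⟨c, hc⟩ := exists_add_of_le (pairExp_le (bad_ne x y hb) hx hy)
    have : m.leadingTerm f =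
        monomial c (m.leadingCoeff f) * m.leadingTerm (quadricBinomial (x, y, x', y')) := by
      rw [leadingTerm_quadricBinomial m hw, monomial_mul, mul_one, MonomialOrder.leadingTerm, hc,
        add_comm c]
    rw [SetLike.mem_coe, this]
    exact Ideal.mul_mem_left _ _ (Ideal.subset_span ⟨_, ⟨_, ⟨hb, hs, hw⟩, rfl⟩, rfl⟩)
  · rintro _ ⟨⟨x, y, x', y'⟩, ⟨hb, -, hw⟩, rfl⟩
    simp only at hb hw
    refine ⟨?_, ?_, fun z => ?_⟩
    · intro h0
      have h1 := leadingTerm_quadricBinomial m hw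
      rw [h0, MonomialOrder.leadingTerm_zero] at h1
      simpa using h1.symm
    · have hp : ∀ x y : σ, (monomial (pairExp x y) (1 : ℂ)).IsHomogeneous 2 := fun x y =>
        isHomogeneous_monomial _ (by simp [pairExp])
      exact (hp _ _).sub (hp _ _)
    · rw [degree_quadricBinomial m hw]
      exact pairExp_le_one (bad_ne x y hb) z

end Order

end ToricKernel

/-! ### Rounding with prescribed parity -/

/-- The integer `x` is the rounding of `S / m` with respect to the parity of `ε`: it equals `S / m`
if this is an integer, and otherwise it is the one of the two neighbouring integers that is
congruent to `ε` modulo `2`. -/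
def IsRounding (ε m S x : ℤ) : Prop := |S - m * x| < m ∧ (¬ 2 ∣ x - ε → S = m * x)

namespace IsRounding

variable {ε m S x y : ℤ}

theorem exists_of_pos (ε : ℤ) (hm : 0 < m) (S : ℤ) : ∃ x, IsRounding ε m S x := by
  have h1 := Int.emod_nonneg S hm.ne'
  have h2 := Int.emod_lt_of_pos S hm
  have h3 := Int.mul_ediv_add_emod S m
  by_cases h0 : S % m = 0
  · exact ⟨S / m, by rw [abs_lt]; constructor <;> linarith, fun _ => by linarith⟩
  by_cases he : 2 ∣ S / m - ε
  · exact ⟨S / m, by rw [abs_lt]; constructor <;> linarith, fun h => absurd he h⟩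
  · refine ⟨S / m + 1, ?_, fun h => absurd (by omega) h⟩
    have : 0 < S % m := by omega
    rw [abs_lt, mul_add]; constructor <;> linarith

theorem unique (hx : IsRounding ε m S x) (hy : IsRounding ε m S y) : x = y := by
  have hm : 0 < m := (abs_nonneg _).trans_lt hx.1
  have h1 := abs_lt.1 hx.1
  have h2 := abs_lt.1 hy.1
  have h3 : x < y + 2 := by
    by_contra h
    nlinarith
  have h4 : y < x + 2 := by
    by_contra h
    nlinarith
  by_contra hne
  by_cases he : 2 ∣ x - ε
  · have h5 := hy.2 (by omega)
    rcases (show x = y + 1 ∨ x = y - 1 by omega) with h | h <;> subst h <;> nlinarith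
  · have h5 := hx.2 he
    rcases (show x = y + 1 ∨ x = y - 1 by omega) with h | h <;> subst h <;> nlinarith

theorem neg (hx : IsRounding ε m S x) : IsRounding ε m (-S) (-x) := by
  refine ⟨?_, fun h => ?_⟩
  · rw [show -S - m * -x = -(S - m * x) by ring, abs_neg]; exact hx.1
  · rw [hx.2 (by omega)]; ring

/-- Rounding respects the inequality `S / m ≤ c`, and so does the remaining part. -/
theorem le (hx : IsRounding ε m S x) {c : ℤ} (h : S ≤ m * c) :
    x ≤ c ∧ S - x ≤ (m - 1) * c := by
  have hm : 0 < m := (abs_nonneg _).trans_lt hx.1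
  have h1 := abs_lt.1 hx.1
  have hxc : x ≤ c := by
    by_contra hlt
    nlinarith
  refine ⟨hxc, ?_⟩
  rcases hxc.eq_or_lt with rfl | hlt
  · linarith
  · have : (m - 1) * x ≤ (m - 1) * (c - 1) := mul_le_mul_of_nonneg_left (by omega) (by omega)
    linarith

/-- Rounding two numbers simultaneously respects an upper bound `c` on their sum, provided that `c`
has the parity of `ε₁ + ε₂`, and so does the remaining part. -/
theorem add_le {ε₁ ε₂ S₁ S₂ x₁ x₂ : ℤ} (h₁ : IsRounding ε₁ m S₁ x₁) (h₂ : IsRounding ε₂ m S₂ x₂)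
    {c : ℤ} (hc : 2 ∣ c - ε₁ - ε₂) (h : S₁ + S₂ ≤ m * c) :
    x₁ + x₂ ≤ c ∧ (S₁ - x₁) + (S₂ - x₂) ≤ (m - 1) * c := by
  have hm : 0 < m := (abs_nonneg _).trans_lt h₁.1
  have a₁ := abs_lt.1 h₁.1
  have a₂ := abs_lt.1 h₂.1
  -- if `x₁ + x₂ - c` is odd, then one of the two coordinates was rounded exactly
  have par : ∀ k, ¬ 2 ∣ k → x₁ + x₂ = c + k → S₁ = m * x₁ ∨ S₂ = m * x₂ := by
    intro k hk hs
    by_cases e₁ : 2 ∣ x₁ - ε₁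
    · exact Or.inr (h₂.2 (by omega))
    · exact Or.inl (h₁.2 e₁)
  constructor
  · by_contra hlt
    rcases (show x₁ + x₂ = c + 1 ∨ c + 2 ≤ x₁ + x₂ by omega) with hs | hs
    · have : m * x₁ + m * x₂ = m * c + m := by linear_combination m * hs
      rcases par 1 (by omega) hs with e | e <;> linarith
    · have : m * (c + 2) ≤ m * (x₁ + x₂) := mul_le_mul_of_nonneg_left hs hm.le
      linarith
  · by_contra hlt
    rw [not_le] at hlt
    obtain ⟨k, hk⟩ : ∃ k, x₁ + x₂ = c - k := ⟨c - x₁ - x₂, by ring⟩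
    have e0 : m * x₁ + m * x₂ = m * c - m * k := by linear_combination m * hk
    have k1 : 0 < k := by
      by_contra hk0
      nlinarith
    have k2 : k < 2 := by
      by_contra hk0
      have : (m - 1) * 2 ≤ (m - 1) * k := mul_le_mul_of_nonneg_left (by omega) (by omega)
      linarith
    obtain rfl : k = 1 := by omega
    rcases par (-1) (by omega) (by omega) with e | e <;> linarith

end IsRounding

/-! ### Chains of lattice points and the height function -/

section Chains

variable {X K : Type} (ε : K → ℤ) (c : X → K → ℤ)

/-- The point `x` lies below `y`: in each coordinate in which they differ, they differ by one and the
coordinate of `x` has the parity of `ε`.  The vertices of an alcove form a chain for this order. -/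
def AlcoveLE (x y : X) : Prop := ∀ i, c x i = c y i ∨ (|c x i - c y i| = 1 ∧ 2 ∣ c x i - ε i)

/-- Neither point lies below the other one: they do not belong to a common alcove. -/
def Incomparable (x y : X) : Prop := ¬ AlcoveLE ε c x y ∧ ¬ AlcoveLE ε c y x

variable {ε c}

theorem AlcoveLE.refl (x : X) : AlcoveLE ε c x x := fun _ => Or.inl rfl

theorem AlcoveLE.trans {x y z : X} (h : AlcoveLE ε c x y) (h' : AlcoveLE ε c y z) :
    AlcoveLE ε c x z := by
  intro i
  rcases h i with h1 | ⟨h1, h2⟩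
  · rw [h1]; exact h' i
  · rcases h' i with h3 | ⟨h3, h4⟩
    · rw [← h3]; exact Or.inr ⟨h1, h2⟩
    · rcases abs_eq (zero_le_one' ℤ) |>.1 h1 with h5 | h5 <;> omega

/-- A finite set without incomparable pairs has a least element. -/
theorem exists_least (s : Multiset X) (hs : s ≠ 0)
    (h : ∀ x ∈ s, ∀ y ∈ s, ¬ Incomparable ε c x y) : ∃ x ∈ s, ∀ y ∈ s, AlcoveLE ε c x y := by
  induction s using Multiset.induction_on with
  | empty => exact absurd rfl hs
  | cons a s ih =>
    by_cases h0 : s = 0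
    · subst h0
      exact ⟨a, by simp, fun y hy => by
        rw [Multiset.mem_cons] at hy
        rcases hy with rfl | hy
        · exact AlcoveLE.refl _
        · simp at hy⟩
    · obtain ⟨x, hx, hle⟩ := ih h0 fun x hx y hy =>
        h x (Multiset.mem_cons_of_mem hx) y (Multiset.mem_cons_of_mem hy)
      have hax := h a (Multiset.mem_cons_self a s) x (Multiset.mem_cons_of_mem hx)
      rw [Incomparable, not_and_or, not_not, not_not] at hax
      rcases hax with hax | hxa
      · refine ⟨a, Multiset.mem_cons_self a s, fun y hy => ?_⟩
        rcases Multiset.mem_cons.1 hy with rfl | hy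
        · exact AlcoveLE.refl _
        · exact hax.trans (hle y hy)
      · refine ⟨x, Multiset.mem_cons_of_mem hx, fun y hy => ?_⟩
        rcases Multiset.mem_cons.1 hy with rfl | hy
        · exact hxa
        · exact hle y hy

/-- The least element of a chain is the rounding of the barycentre of the chain. -/
theorem isRounding_least (x : X) (s : Multiset X) (h : ∀ y ∈ s, AlcoveLE ε c x y) (i : K) :
    IsRounding (ε i) (Multiset.card (x ::ₘ s)) ((x ::ₘ s).map (c · i)).sum (c x i) := by
  have key : ∀ t : Multiset X, (∀ y ∈ t, AlcoveLE ε c x y) →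
      |(t.map (c · i)).sum - Multiset.card t * c x i| ≤ Multiset.card t ∧
      (¬ 2 ∣ c x i - ε i → (t.map (c · i)).sum = Multiset.card t * c x i) := by
    intro t
    induction t using Multiset.induction_on with
    | empty => simp
    | cons a t ih =>
      intro ht
      obtain ⟨h1, h2⟩ := ih fun y hy => ht y (Multiset.mem_cons_of_mem hy)
      have ha := ht a (Multiset.mem_cons_self a t) i
      rw [Multiset.map_cons, Multiset.sum_cons, Multiset.card_cons]
      push_cast
      refine ⟨?_, fun he => ?_⟩
      · have h3 : |c a i - c x i| ≤ 1 := by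
          rcases ha with ha | ⟨ha, -⟩
          · rw [ha]; simp
          · rw [abs_sub_comm, ha]
        calc _ = |(c a i - c x i) + ((t.map (c · i)).sum - Multiset.card t * c x i)| := by
              congr 1; ring
          _ ≤ _ := (abs_add_le _ _).trans (by linarith)
      · rcases ha with ha | ⟨-, ha⟩
        · rw [h2 he, ← ha]; ring
        · exact absurd ha he
  obtain ⟨h1, h2⟩ := key s h
  rw [Multiset.map_cons, Multiset.sum_cons, Multiset.card_cons]
  push_cast
  refine ⟨?_, fun he => ?_⟩
  · rw [show c x i + (s.map (c · i)).sum - (Multiset.card s + 1) * c x i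
      = (s.map (c · i)).sum - Multiset.card s * c x i by ring]
    linarith
  · rw [h2 he]; ring

/-- A chain is determined by its length and its sum. -/
theorem chain_unique (hc : Function.Injective c) (s t : Multiset X)
    (hs : ∀ x ∈ s, ∀ y ∈ s, ¬ Incomparable ε c x y)
    (ht : ∀ x ∈ t, ∀ y ∈ t, ¬ Incomparable ε c x y)
    (hcard : Multiset.card s = Multiset.card t)
    (hsum : ∀ i, (s.map (c · i)).sum = (t.map (c · i)).sum) : s = t := by
  induction hn : Multiset.card s generalizing s t with
  | zero =>
    rw [Multiset.card_eq_zero] at hn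
    subst hn
    exact (Multiset.card_eq_zero.1 (by rw [← hcard]; rfl)).symm
  | succ n ih =>
    have hs0 : s ≠ 0 := by rintro rfl; simp at hn
    have ht0 : t ≠ 0 := by rintro rfl; rw [hcard] at hn; simp at hn
    obtain ⟨x, hx, hxle⟩ := exists_least s hs0 hs
    obtain ⟨y, hy, hyle⟩ := exists_least t ht0 ht
    obtain ⟨s, rfl⟩ := Multiset.exists_cons_of_mem hx
    obtain ⟨t, rfl⟩ := Multiset.exists_cons_of_mem hy
    have hxy : x = y := hc <| funext fun i => by
      have h1 := isRounding_least x s (fun z hz => hxle z (Multiset.mem_cons_of_mem hz)) i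
      have h2 := isRounding_least y t (fun z hz => hyle z (Multiset.mem_cons_of_mem hz)) i
      rw [hcard, hsum i] at h1
      exact h1.unique h2
    subst hxy
    congr 1
    refine ih s t (fun x hx y hy => hs x (Multiset.mem_cons_of_mem hx) y
      (Multiset.mem_cons_of_mem hy)) (fun x hx y hy => ht x (Multiset.mem_cons_of_mem hx) y
      (Multiset.mem_cons_of_mem hy)) (by simpa using hcard) (fun i => ?_) (by simpa using hn)
    simpa using hsum i

variable [Fintype K] (ε c)

/-- The number of coordinates whose parity differs from that of `ε`. -/
def oddCount (x : X) : ℕ := (Finset.univ.filter fun i => ¬ (2 : ℤ) ∣ c x i - ε i).card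

/-- The height of a point, which induces the triangulation into alcoves.  The squared norm prefers
points with a common cell of the integer grid; it is scaled so as to dominate the second term, which
prefers, within a cell, pairs of points with extreme numbers of odd coordinates. -/
def alcoveHeight (x : X) : ℕ :=
  (Fintype.card K ^ 2 + 1) * 2 * ∑ i, (c x i).natAbs ^ 2 +
    (Fintype.card K ^ 2 - oddCount ε c x ^ 2)

theorem oddCount_le (x : X) : oddCount ε c x ≤ Fintype.card K := Finset.card_le_univ _

theorem alcoveHeight_eq (x : X) : (alcoveHeight ε c x : ℤ) =
    (Fintype.card K ^ 2 + 1) * 2 * ∑ i, c x i ^ 2 + (Fintype.card K ^ 2 - oddCount ε c x ^ 2) := by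
  have h := Nat.pow_le_pow_left (oddCount_le ε c x) 2
  rw [alcoveHeight]
  push_cast [Nat.cast_sub h]
  simp

/-- Rounding the midpoint of two points that do not lie in a common alcove decreases the height. -/
theorem alcoveHeight_lt {x y x' y' : X} (hxy : Incomparable ε c x y)
    (hs : ∀ i, c x i + c y i = c x' i + c y' i)
    (hr : ∀ i, IsRounding (ε i) 2 (c x i + c y i) (c x' i)) :
    alcoveHeight ε c x' + alcoveHeight ε c y' < alcoveHeight ε c x + alcoveHeight ε c y := by
  have hsq : ∀ i, c x' i ^ 2 + c y' i ^ 2 ≤ c x i ^ 2 + c y i ^ 2 ∧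
      (|c x i - c y i| ≤ 1 ∨ c x' i ^ 2 + c y' i ^ 2 + 1 ≤ c x i ^ 2 + c y i ^ 2) := by
    intro i
    have h1 := abs_lt.1 (hr i).1
    have h2 := hs i
    obtain ⟨u, hu⟩ : ∃ u, c x i - c y i = u := ⟨_, rfl⟩
    obtain ⟨v, hv⟩ : ∃ v, c x' i - c y' i = v := ⟨_, rfl⟩
    have hv1 : v = 0 ∨ v = 1 ∨ v = -1 := by omega
    have e : 2 * (c x i ^ 2 + c y i ^ 2) - 2 * (c x' i ^ 2 + c y' i ^ 2) = u ^ 2 - v ^ 2 := by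
      rw [← hu, ← hv]
      linear_combination (c x i + c y i + c x' i + c y' i) * h2
    rw [hu]
    have hpar : 2 ∣ u - v := by omega
    rcases le_or_gt |u| 1 with hle | hgt
    · refine ⟨?_, Or.inl hle⟩
      have := abs_le.1 hle
      have hu1 : u = 0 ∨ u = 1 ∨ u = -1 := by omega
      rcases hu1 with rfl | rfl | rfl <;> rcases hv1 with rfl | rfl | rfl <;> omega
    · have h4 : 2 ^ 2 ≤ u ^ 2 := sq_le_sq.2 (by rw [abs_two]; omega)
      have hv2 : v ^ 2 ≤ 1 := by rcases hv1 with rfl | rfl | rfl <;> norm_num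
      constructor
      · omega
      · right; omega
  zify
  simp only [alcoveHeight_eq]
  have hN := fun z => oddCount_le ε c z
  -- within a cell of the grid the squared norms agree, and the second term decides
  by_cases hall : ∀ i, |c x i - c y i| ≤ 1
  · have hle : ∑ i, (c x' i ^ 2 + c y' i ^ 2) ≤ ∑ i, (c x i ^ 2 + c y i ^ 2) :=
      Finset.sum_le_sum fun j _ => (hsq j).1
    rw [Finset.sum_add_distrib, Finset.sum_add_distrib] at hle
    have hcount : oddCount ε c x + oddCount ε c y = oddCount ε c x' + oddCount ε c y' := by
      simp only [oddCount, Finset.card_filter]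
      rw [← Finset.sum_add_distrib, ← Finset.sum_add_distrib]
      refine Finset.sum_congr rfl fun i _ => ?_
      have h1 := abs_lt.1 (hr i).1
      have h2 := hs i
      have h3 := abs_le.1 (hall i)
      have h4 := (hr i).2
      split_ifs <;> omega
    have hx' : ∀ z, (∀ i, c x' i = c z i ∨ 2 ∣ c x' i - ε i) →
        (∃ i, 2 ∣ c x' i - ε i ∧ ¬ 2 ∣ c z i - ε i) → oddCount ε c x' < oddCount ε c z := by
      rintro z h1 ⟨i, h2, h3⟩
      refine Finset.card_lt_card (Finset.ssubset_iff_subset_ne.2 ⟨fun j hj => ?_, fun h => ?_⟩)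
      · rw [Finset.mem_filter] at hj ⊢
        rcases h1 j with h | h
        · rw [← h]; exact hj
        · exact absurd h hj.2
      · have : i ∈ Finset.univ.filter fun i => ¬ (2 : ℤ) ∣ c z i - ε i := by simpa using h3
        rw [← h, Finset.mem_filter] at this
        exact this.2 h2
    obtain ⟨h1, h2⟩ := hxy
    simp only [AlcoveLE, not_forall, not_or, not_and] at h1 h2
    have hx : oddCount ε c x' < oddCount ε c x := by
      refine hx' x (fun i => ?_) ?_
      · have h1 := abs_lt.1 (hr i).1
        have h2 := hs i
        have h3 := abs_le.1 (hall i)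
        have h4 := (hr i).2
        omega
      · obtain ⟨i, hne, h⟩ := h1
        refine ⟨i, ?_, h ?_⟩
        · by_contra hd
          have h3 := abs_le.1 (hall i)
          have h4 := (hr i).2 hd
          omega
        · have := abs_pos.2 (sub_ne_zero.2 hne)
          have := hall i
          omega
    have hy : oddCount ε c x' < oddCount ε c y := by
      refine hx' y (fun i => ?_) ?_
      · have h1 := abs_lt.1 (hr i).1
        have h2 := hs i
        have h3 := abs_le.1 (hall i)
        have h4 := (hr i).2
        omega
      · obtain ⟨i, hne, h⟩ := h2
        refine ⟨i, ?_, h ?_⟩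
        · by_contra hd
          have h3 := abs_le.1 (hall i)
          have h4 := (hr i).2 hd
          omega
        · have := abs_pos.2 (sub_ne_zero.2 hne)
          have := hall i
          rw [abs_sub_comm] at this
          omega
    -- the new pair of counts has the same sum as the old one, but is more spread out
    have hsqn : (oddCount ε c x : ℤ) ^ 2 + (oddCount ε c y : ℤ) ^ 2 <
        (oddCount ε c x' : ℤ) ^ 2 + (oddCount ε c y' : ℤ) ^ 2 := by
      zify at hcount hx hy
      have e : (oddCount ε c y' : ℤ) = oddCount ε c x + oddCount ε c y - oddCount ε c x' := by
        linarith
      rw [e]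
      nlinarith [mul_pos (sub_pos.2 hx) (sub_pos.2 hy)]
    have hmul := mul_le_mul_of_nonneg_left hle
      (show (0 : ℤ) ≤ ((Fintype.card K : ℤ) ^ 2 + 1) * 2 by positivity)
    linarith
  · push Not at hall
    obtain ⟨i, hi⟩ := hall
    have hlt : ∑ i, (c x' i ^ 2 + c y' i ^ 2) < ∑ i, (c x i ^ 2 + c y i ^ 2) := by
      refine Finset.sum_lt_sum (fun j _ => (hsq j).1) ⟨i, Finset.mem_univ i, ?_⟩
      rcases (hsq i).2 with h | h
      · exact absurd h (by omega)
      · omega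
    rw [Finset.sum_add_distrib, Finset.sum_add_distrib] at hlt
    have h1 : (0 : ℤ) ≤ (oddCount ε c x' : ℤ) ^ 2 := sq_nonneg _
    have h2 : (0 : ℤ) ≤ (oddCount ε c y' : ℤ) ^ 2 := sq_nonneg _
    have h3 : (oddCount ε c x : ℤ) ^ 2 ≤ (Fintype.card K : ℤ) ^ 2 := by
      exact_mod_cast Nat.pow_le_pow_left (hN x) 2
    have h4 : (oddCount ε c y : ℤ) ^ 2 ≤ (Fintype.card K : ℤ) ^ 2 := by
      exact_mod_cast Nat.pow_le_pow_left (hN y) 2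
    nlinarith

end Chains

/-! ### Polytopes with alcoved coordinates -/

namespace LatticePolytope

variable {ι : Type} {M : AddSubgroup (ι → ℝ)} {P : Set (ι → ℝ)}

theorem single_sum_mem_adjoin (t : Multiset (latticePoints M P)) :
    (AddMonoidAlgebra.single (t.map degreeOne).sum 1 : toricAlgebra M P) ∈
      Algebra.adjoin ℂ {f : toricAlgebra M P |
        ∃ s : gradedSemigroup M P, s.1.1 = 1 ∧ f = AddMonoidAlgebra.single s 1} := by
  induction t using Multiset.induction_on with
  | empty => exact one_mem _
  | cons x t ih =>
    rw [Multiset.map_cons, Multiset.sum_cons]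
    have hx : (AddMonoidAlgebra.single (degreeOne x) 1 : toricAlgebra M P) ∈
        {f : toricAlgebra M P |
          ∃ s : gradedSemigroup M P, s.1.1 = 1 ∧ f = AddMonoidAlgebra.single s 1} :=
      ⟨degreeOne x, rfl, rfl⟩
    have := mul_mem (Algebra.subset_adjoin (R := ℂ) hx) ih
    rwa [AddMonoidAlgebra.single_mul_single, one_mul] at this

theorem val_sum_degreeOne (t : Multiset (latticePoints M P)) :
    ((t.map degreeOne).sum : gradedSemigroup M P).1 =
      (Multiset.card t, (t.map Subtype.val).sum) := by
  induction t using Multiset.induction_on with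
  | empty => rfl
  | cons x t ih =>
    rw [Multiset.map_cons, Multiset.sum_cons, AddSubmonoid.coe_add, ih, Multiset.card_cons,
      Multiset.map_cons, Multiset.sum_cons, degreeOne, Prod.mk_add_mk, add_comm 1]

theorem generatedInDegreeOne_of_exists_sum
    (h : ∀ m, ∀ x ∈ M, x ∈ minkowskiSum P m →
      ∃ t : Multiset (latticePoints M P), Multiset.card t = m ∧ (t.map Subtype.val).sum = x) :
    GeneratedInDegreeOne M P := by
  rw [GeneratedInDegreeOne, eq_top_iff]
  rintro f -
  induction f using AddMonoidAlgebra.induction_linear with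
  | zero => exact zero_mem _
  | add f g hf hg => exact add_mem hf hg
  | single s c =>
    obtain ⟨t, ht, hx⟩ := h s.1.1 s.1.2 s.2.1 s.2.2
    have hs : s = (t.map degreeOne).sum := Subtype.ext (by rw [val_sum_degreeOne, ht, hx])
    have := Subalgebra.smul_mem _ (single_sum_mem_adjoin t) c
    rw [AddMonoidAlgebra.smul_single, smul_eq_mul, mul_one, ← hs] at this
    exact this

/-- The integer points of the dilates of an alcoved polytope of type `C`, in coordinates in which
the lattice is `ℤ ^ K`: the points of `D m` lie in the `m`-fold dilate, and rounding `z / (m + 1)`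
splits a point `z` of `D (m + 1)` into a point of `D 1` and one of `D m`. -/
structure AlcovedCoordinates {K : Type} (M : AddSubgroup (ι → ℝ)) (P : Set (ι → ℝ))
    (φ : (K → ℤ) →+ (ι → ℝ)) (D : ℕ → Set (K → ℤ)) (ε : K → ℤ) : Prop where
  injective : Function.Injective φ
  exists_coord : ∀ m, ∀ x ∈ M, x ∈ minkowskiSum P m → ∃ z ∈ D m, φ z = x
  mem_lattice : ∀ z ∈ D 1, φ z ∈ M
  mem_polytope : ∀ z ∈ D 1, φ z ∈ P
  split : ∀ m, 0 < m → ∀ z ∈ D (m + 1), ∀ x : K → ℤ,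
    (∀ i, IsRounding (ε i) (m + 1) (z i) (x i)) → x ∈ D 1 ∧ z - x ∈ D m

namespace AlcovedCoordinates

variable {K : Type} {φ : (K → ℤ) →+ (ι → ℝ)} {D : ℕ → Set (K → ℤ)} {ε : K → ℤ}

theorem exists_sum (h : AlcovedCoordinates M P φ D ε) (m : ℕ) (z : K → ℤ) (hz : z ∈ D (m + 1)) :
    ∃ t : Multiset (latticePoints M P), Multiset.card t = m + 1 ∧
      (t.map Subtype.val).sum = φ z := by
  induction m generalizing z with
  | zero => exact ⟨{⟨φ z, h.mem_lattice z hz, h.mem_polytope z hz⟩}, by simp, by simp⟩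
  | succ m ih =>
    choose x hx using fun i => IsRounding.exists_of_pos (ε i) (m := ((m + 1 : ℕ) : ℤ) + 1)
      (by positivity) (z i)
    obtain ⟨h1, h2⟩ := h.split (m + 1) m.succ_pos z hz x hx
    obtain ⟨t, ht, hs⟩ := ih _ h2
    refine ⟨⟨φ x, h.mem_lattice x h1, h.mem_polytope x h1⟩ ::ₘ t, by simp [ht], ?_⟩
    rw [Multiset.map_cons, Multiset.sum_cons, hs, ← map_add, add_sub_cancel]

theorem generatedInDegreeOne (h : AlcovedCoordinates M P φ D ε) : GeneratedInDegreeOne M P := by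
  refine generatedInDegreeOne_of_exists_sum fun m x hM hx => ?_
  rcases m with _ | m
  · obtain ⟨p, -, rfl⟩ := hx
    exact ⟨0, by simp, by simp⟩
  · obtain ⟨z, hz, rfl⟩ := h.exists_coord _ x hM hx
    exact h.exists_sum m z hz

theorem exists_latticePoint_coord (h : AlcovedCoordinates M P φ D ε) (x : latticePoints M P) : ∃ z ∈ D 1, φ z = x.1 :=
  h.exists_coord 1 x.1 x.2.1 ⟨fun _ => x.1, fun _ => x.2.2, by simp⟩

/-- The coordinates of a lattice point. -/
noncomputable def coord (h : AlcovedCoordinates M P φ D ε) (x : latticePoints M P) : K → ℤ := (h.exists_latticePoint_coord x).choose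

theorem map_coord (h : AlcovedCoordinates M P φ D ε) (x : latticePoints M P) : φ (h.coord x) = x.1 :=
  (h.exists_latticePoint_coord x).choose_spec.2

theorem coord_injective (h : AlcovedCoordinates M P φ D ε) : Function.Injective h.coord := fun x y hxy =>
  Subtype.ext (by rw [← h.map_coord, hxy, h.map_coord])

theorem map_sum_coord (h : AlcovedCoordinates M P φ D ε) (t : Multiset (latticePoints M P)) :
    φ (t.map h.coord).sum = (t.map Subtype.val).sum := by
  rw [map_multiset_sum, Multiset.map_map]
  congr 1
  exact Multiset.map_congr rfl fun x _ => h.map_coord x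

theorem sum_coord_apply (h : AlcovedCoordinates M P φ D ε) (t : Multiset (latticePoints M P)) (i : K) :
    (t.map (h.coord · i)).sum = (t.map h.coord).sum i := by
  have := map_multiset_sum (Pi.evalAddMonoidHom (fun _ : K => ℤ) i) (t.map h.coord)
  rw [Multiset.map_map] at this
  exact this.symm

theorem exchange (h : AlcovedCoordinates M P φ D ε) (x y : latticePoints M P) : ∃ x' y' : latticePoints M P,
    x.1 + y.1 = x'.1 + y'.1 ∧ (∀ i, h.coord x i + h.coord y i = h.coord x' i + h.coord y' i) ∧
    ∀ i, IsRounding (ε i) 2 (h.coord x i + h.coord y i) (h.coord x' i) := by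
  obtain ⟨z, hz, hzs⟩ := h.exists_coord 2 (x.1 + y.1) (M.add_mem x.2.1 y.2.1)
    ⟨![x.1, y.1], by
      intro i
      fin_cases i
      · exact x.2.2
      · exact y.2.2, by simp [Fin.sum_univ_two]⟩
  have hz' : z = h.coord x + h.coord y :=
    h.injective (by rw [hzs, map_add, h.map_coord, h.map_coord])
  choose p hp using fun i => IsRounding.exists_of_pos (ε i) (m := ((1 : ℕ) : ℤ) + 1)
    (by norm_num) (z i)
  obtain ⟨h1, h2⟩ := h.split 1 one_pos z hz p hp
  let x' : latticePoints M P := ⟨φ p, h.mem_lattice p h1, h.mem_polytope p h1⟩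
  let y' : latticePoints M P := ⟨φ (z - p), h.mem_lattice _ h2, h.mem_polytope _ h2⟩
  have hx' : h.coord x' = p := h.injective (h.map_coord x')
  have hy' : h.coord y' = z - p := h.injective (h.map_coord y')
  refine ⟨x', y', ?_, fun i => ?_, fun i => ?_⟩
  · rw [← hzs, ← map_add, add_sub_cancel]
  · rw [hx', hy', hz', Pi.sub_apply, Pi.add_apply]; ring
  · rw [hx']
    have := hp i
    rw [hz'] at this
    simpa using this

theorem hasQuadraticSquarefreeGroebnerBasis [Fintype K] [Finite (latticePoints M P)]
    (h : AlcovedCoordinates M P φ D ε) :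
    HasQuadraticSquarefreeGroebnerBasis (toricIdeal M P) := by
  classical
  obtain ⟨m, hm⟩ := MonomialOrder.exists_weighted (alcoveHeight ε h.coord)
  refine hasQuadraticSquarefreeGroebnerBasis_of_exchange (a := degreeOne)
    (m := m) (Bad := Incomparable ε h.coord)
    ?_ ?_ ?_
  · rintro x _ hb rfl
    exact hb.1 (AlcoveLE.refl x)
  · intro x y hb
    obtain ⟨x', y', h1, h2, h3⟩ := h.exchange x y
    refine ⟨x', y', Subtype.ext ?_, hm _ _ ?_⟩
    · exact congrArg (fun s => ((2, s) : ℕ × (ι → ℝ))) h1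
    · simpa [pairExp] using alcoveHeight_lt ε h.coord hb h2 h3
  · intro d e hd he hde
    have key : ∀ d : latticePoints M P →₀ ℕ, (monoidDegree degreeOne d).1 =
        (Multiset.card (Finsupp.toMultiset d), ((Finsupp.toMultiset d).map Subtype.val).sum) :=
      fun d => val_sum_degreeOne _
    have hde' := congrArg Subtype.val hde
    rw [key, key, Prod.mk.injEq] at hde'
    have hmem : ∀ (d : latticePoints M P →₀ ℕ) x, x ∈ Finsupp.toMultiset d → x ∈ d.support :=
      fun d x hx => (Finsupp.mem_toMultiset d x).1 hx
    refine Finsupp.orderIsoMultiset.injective (chain_unique h.coord_injective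
      (Finsupp.toMultiset d) (Finsupp.toMultiset e)
      (fun x hx y hy => hd x (hmem d x hx) y (hmem d y hy))
      (fun x hx y hy => he x (hmem e x hx) y (hmem e y hy)) hde'.1 fun i => ?_)
    rw [h.sum_coord_apply, h.sum_coord_apply]
    refine congrFun (h.injective ?_) i
    rw [h.map_sum_coord, h.map_sum_coord, hde'.2]

end AlcovedCoordinates

end LatticePolytope

/-! ### Weight polytopes of trivalent graphs -/

/-- The three weights at a trinode satisfy the triangle inequalities, and their sum is at most
`B`. -/
def IsTriangle (a b c B : ℤ) : Prop := a ≤ b + c ∧ b ≤ a + c ∧ c ≤ a + b ∧ a + b + c ≤ B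

theorem isTriangle_perm (f : Fin 3 → ℤ) (B : ℤ) {i j k : Fin 3} (hij : i ≠ j) (hjk : j ≠ k)
    (hik : i ≠ k) : IsTriangle (f 0) (f 1) (f 2) B ↔ IsTriangle (f i) (f j) (f k) B := by
  unfold IsTriangle
  fin_cases i <;> fin_cases j <;> fin_cases k <;> simp at hij hjk hik ⊢ <;> omega

theorem sum_perm {R : Type} [AddCommMonoid R] (f : Fin 3 → R) {i j k : Fin 3} (hij : i ≠ j)
    (hjk : j ≠ k) (hik : i ≠ k) : f 0 + f 1 + f 2 = f i + f j + f k := by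
  have : (Finset.univ : Finset (Fin 3)) = {i, j, k} := by
    revert i j k; decide
  rw [← Fin.sum_univ_three, this, Finset.sum_insert (by simp [hij, hik]),
    Finset.sum_insert (by simpa using hjk), Finset.sum_singleton, add_assoc]

theorem eq_or_eq_or_eq (n : Fin 3) {i j k : Fin 3} (hij : i ≠ j) (hjk : j ≠ k) (hik : i ≠ k) :
    n = i ∨ n = j ∨ n = k := by
  revert n i j k; decide

namespace TrivalentGraph

variable {Γ : TrivalentGraph}

theorem exists_halfEdge (Γ : TrivalentGraph) (e : Γ.E) : ∃ h, Γ.attach h = e := by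
  obtain ⟨h, k, -, H⟩ := Γ.two_ends e
  exact ⟨h, (H h).2 (Or.inl rfl)⟩

theorem intCast_mem_polytope_iff (w : Γ.E → ℤ) (ρ : Γ.Leaf → ℕ) (L : ℕ) :
    (fun e => (w e : ℝ)) ∈ Γ.polytope ρ L ↔
      (∀ v, IsTriangle (w (Γ.edgeAt v 0)) (w (Γ.edgeAt v 1)) (w (Γ.edgeAt v 2)) (2 * L)) ∧
      ∀ l, w (Γ.leafEdge l) = ρ l := by
  simp only [polytope, Set.mem_ofPred_eq]
  constructor
  · rintro ⟨-, h1, h2, h3⟩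
    refine ⟨fun v => ?_, fun l => by exact_mod_cast h3 l⟩
    obtain ⟨h4, h5⟩ := h1 v
    obtain ⟨h6, h7⟩ := abs_le.1 h4
    have h8 := h2 v
    refine ⟨?_, ?_, ?_, ?_⟩
    · have : (w (Γ.edgeAt v 0) : ℝ) ≤ w (Γ.edgeAt v 1) + w (Γ.edgeAt v 2) := by linarith
      exact_mod_cast this
    · have : (w (Γ.edgeAt v 1) : ℝ) ≤ w (Γ.edgeAt v 0) + w (Γ.edgeAt v 2) := by linarith
      exact_mod_cast this
    · exact_mod_cast h5
    · exact_mod_cast h8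
  · rintro ⟨h1, h2⟩
    refine ⟨fun e => ?_, fun v => ?_, fun v => ?_, fun l => by exact_mod_cast h2 l⟩
    · obtain ⟨⟨v, i⟩ | l, rfl⟩ := Γ.exists_halfEdge e
      · obtain ⟨h3, h4, h5, -⟩ := h1 v
        have : 0 ≤ w (Γ.edgeAt v i) := by
          fin_cases i
          · change 0 ≤ w (Γ.edgeAt v 0); omega
          · change 0 ≤ w (Γ.edgeAt v 1); omega
          · change 0 ≤ w (Γ.edgeAt v 2); omega
        exact_mod_cast this
      · have : 0 ≤ w (Γ.leafEdge l) := by rw [h2]; positivity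
        exact_mod_cast this
    · obtain ⟨h3, h4, h5, -⟩ := h1 v
      refine ⟨abs_le.2 ⟨?_, ?_⟩, by exact_mod_cast h5⟩
      · have : -w (Γ.edgeAt v 2) ≤ w (Γ.edgeAt v 0) - w (Γ.edgeAt v 1) := by omega
        exact_mod_cast this
      · have : w (Γ.edgeAt v 0) - w (Γ.edgeAt v 1) ≤ w (Γ.edgeAt v 2) := by omega
        exact_mod_cast this
    · exact_mod_cast (h1 v).2.2.2

/-- The edge weights in the polytope are bounded. -/
theorem exists_bound (Γ : TrivalentGraph) (ρ : Γ.Leaf → ℕ) (L : ℕ) (e : Γ.E) :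
    ∃ B : ℤ, ∀ w ∈ Γ.polytope ρ L, w e ≤ B := by
  obtain ⟨⟨v, i⟩ | l, rfl⟩ := Γ.exists_halfEdge e
  · refine ⟨2 * L, fun w hw => ?_⟩
    have h1 := hw.2.2.1 v
    have h2 := hw.1 (Γ.edgeAt v 0)
    have h3 := hw.1 (Γ.edgeAt v 1)
    have h4 := hw.1 (Γ.edgeAt v 2)
    push_cast
    fin_cases i
    · change w (Γ.edgeAt v 0) ≤ _; linarith
    · change w (Γ.edgeAt v 1) ≤ _; linarith
    · change w (Γ.edgeAt v 2) ≤ _; linarith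
  · exact ⟨ρ l, fun w hw => (hw.2.2.2 l).le⟩

theorem finite_latticePoints (Γ : TrivalentGraph) (ρ : Γ.Leaf → ℕ) (L : ℕ) :
    Finite (LatticePolytope.latticePoints Γ.lattice (Γ.polytope ρ L)) := by
  have := Γ.finite_E
  choose B hB using Γ.exists_bound ρ L
  refine Set.Finite.subset (Set.Finite.pi' fun e : Γ.E =>
    (Set.finite_Icc (0 : ℤ) (B e)).image (fun k : ℤ => (k : ℝ))) ?_
  rintro w ⟨hM, hP⟩ e
  obtain ⟨k, hk⟩ := hM.1 e
  have h1 := hP.1 e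
  have h2 := hB e w hP
  rw [hk] at h1 h2
  exact ⟨k, ⟨by exact_mod_cast h1, by exact_mod_cast h2⟩, hk.symm⟩

theorem minkowskiSum_polytope_subset (ρ : Γ.Leaf → ℕ) (L m : ℕ) :
    LatticePolytope.minkowskiSum (Γ.polytope ρ L) m ⊆
      Γ.polytope (fun l => m * ρ l) (m * L) := by
  rintro _ ⟨p, hp, rfl⟩
  have tri : ∀ (i : Fin m) v, |p i (Γ.edgeAt v 0) - p i (Γ.edgeAt v 1)| ≤ p i (Γ.edgeAt v 2) :=
    fun i v => ((hp i).2.1 v).1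
  refine ⟨fun e => ?_, fun v => ⟨?_, ?_⟩, fun v => ?_, fun l => ?_⟩
  · rw [Finset.sum_apply]
    exact Finset.sum_nonneg fun i _ => (hp i).1 e
  · simp only [Finset.sum_apply]
    rw [← Finset.sum_sub_distrib]
    exact (Finset.abs_sum_le_sum_abs _ _).trans (Finset.sum_le_sum fun i _ => tri i v)
  · simp only [Finset.sum_apply]
    rw [← Finset.sum_add_distrib]
    exact Finset.sum_le_sum fun i _ => ((hp i).2.1 v).2
  · simp only [Finset.sum_apply]
    rw [← Finset.sum_add_distrib, ← Finset.sum_add_distrib]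
    refine (Finset.sum_le_sum fun i _ => (hp i).2.2.1 v).trans ?_
    simp; linarith
  · simp only [Finset.sum_apply]
    rw [Finset.sum_congr rfl fun i _ => (hp i).2.2.2 l]
    simp

/-! ### Coordinates on the weightings of a caterpillar graph -/

/-- The role of an edge in a caterpillar graph: a separating edge, a loop, or one of the two edges
of a doubled edge, which carry the half sum and the half difference of the two weights as their
coordinates. -/
inductive EdgeKind
  | separating | loop | halfSum | halfDiff

/-- The edge weights with given coordinates; `τ` exchanges the two edges of a doubled edge.  The
weight of a separating edge is twice its coordinate. -/
def coordWeight (kind : Γ.E → EdgeKind) (τ : Γ.E → Γ.E) (z : Γ.E → ℤ) (e : Γ.E) : ℤ :=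
  match kind e with
  | .separating => 2 * z e
  | .loop => z e
  | .halfSum => z e + z (τ e)
  | .halfDiff => z (τ e) - z e

/-- The edge weights as a homomorphism from the coordinates to the real weightings. -/
def coordMap (kind : Γ.E → EdgeKind) (τ : Γ.E → Γ.E) : (Γ.E → ℤ) →+ (Γ.E → ℝ) where
  toFun z e := coordWeight kind τ z e
  map_zero' := by ext e; simp only [coordWeight]; split <;> simp
  map_add' x y := by
    ext e
    simp only [coordWeight, Pi.add_apply]
    split <;> push_cast <;> ring

/-- The possible shapes of a trinode of a caterpillar graph: it meets a leaf edge and two further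
separating edges, or a loop, or a doubled edge.  The parities `ε` of the coordinates satisfy the
congruences that make the facet inequalities at the trinode alcoved. -/
inductive TrinodeShape (Γ : TrivalentGraph) (kind : Γ.E → EdgeKind) (τ : Γ.E → Γ.E)
    (ρ : Γ.Leaf → ℕ) (ε : Γ.E → ℤ) (v : Γ.V) : Prop
  | leaf (i j k : Fin 3) (l : Γ.Leaf) : i ≠ j → j ≠ k → i ≠ k → Γ.edgeAt v k = Γ.leafEdge l →
      kind (Γ.edgeAt v i) = .separating → kind (Γ.edgeAt v j) = .separating →
      2 ∣ (ρ l : ℤ) - ε (Γ.edgeAt v i) - ε (Γ.edgeAt v j) → TrinodeShape Γ kind τ ρ ε v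
  | loop (i j k : Fin 3) : i ≠ j → j ≠ k → i ≠ k → Γ.edgeAt v j = Γ.edgeAt v k →
      kind (Γ.edgeAt v i) = .separating → kind (Γ.edgeAt v j) = .loop →
      2 ∣ ε (Γ.edgeAt v i) - ε (Γ.edgeAt v j) → TrinodeShape Γ kind τ ρ ε v
  | doubled (i j k : Fin 3) : i ≠ j → j ≠ k → i ≠ k → τ (Γ.edgeAt v j) = Γ.edgeAt v k →
      τ (Γ.edgeAt v k) = Γ.edgeAt v j → kind (Γ.edgeAt v i) = .separating →
      kind (Γ.edgeAt v j) = .halfSum → kind (Γ.edgeAt v k) = .halfDiff →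
      2 ∣ ε (Γ.edgeAt v i) - ε (Γ.edgeAt v j) → 2 ∣ ε (Γ.edgeAt v i) - ε (Γ.edgeAt v k) →
      TrinodeShape Γ kind τ ρ ε v

/-- The edges of `Γ` are of the given kinds: all trinodes have admissible shapes (for a suitable
choice of parities), and integral weightings in the lattice with even leaf weights are even at all
separating edges. -/
structure IsCaterpillarShape (Γ : TrivalentGraph) (kind : Γ.E → EdgeKind) (τ : Γ.E → Γ.E) :
    Prop where
  kind_leafEdge : ∀ l, kind (Γ.leafEdge l) = .separating
  even_of_separating : ∀ k : Γ.E → ℤ,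
    (∀ v, 2 ∣ k (Γ.edgeAt v 0) + k (Γ.edgeAt v 1) + k (Γ.edgeAt v 2)) →
    (∀ l, 2 ∣ k (Γ.leafEdge l)) → ∀ e, kind e = .separating → 2 ∣ k e
  exists_parity : ∀ ρ : Γ.Leaf → ℕ, ∃ ε : Γ.E → ℤ, ∀ v, TrinodeShape Γ kind τ ρ ε v

namespace IsCaterpillarShape

variable {kind : Γ.E → EdgeKind} {τ : Γ.E → Γ.E}

theorem exists_doubled (h : IsCaterpillarShape Γ kind τ) (e : Γ.E)
    (he : kind e = .halfSum ∨ kind e = .halfDiff) :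
    ∃ v, ∃ i j k : Fin 3, i ≠ j ∧ j ≠ k ∧ i ≠ k ∧ kind (Γ.edgeAt v i) = .separating ∧
      kind (Γ.edgeAt v j) = .halfSum ∧ kind (Γ.edgeAt v k) = .halfDiff ∧
      τ (Γ.edgeAt v j) = Γ.edgeAt v k ∧ τ (Γ.edgeAt v k) = Γ.edgeAt v j ∧
      (kind e = .halfSum → e = Γ.edgeAt v j) ∧ (kind e = .halfDiff → e = Γ.edgeAt v k) := by
  obtain ⟨⟨v, n⟩ | l, rfl⟩ := Γ.exists_halfEdge e
  · obtain ⟨ε, hε⟩ := h.exists_parity 0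
    have cases := @eq_or_eq_or_eq n
    change kind (Γ.edgeAt v n) = _ ∨ kind (Γ.edgeAt v n) = _ at he
    rcases hε v with ⟨i, j, k, l, hij, hjk, hik, h1, h2, h3, -⟩ |
      ⟨i, j, k, hij, hjk, hik, h1, h2, h3, -⟩ |
      ⟨i, j, k, hij, hjk, hik, h1, h2, h3, h4, h5, -, -⟩
    · exfalso
      have h4 := h.kind_leafEdge l
      rw [← h1] at h4
      rcases cases hij hjk hik with rfl | rfl | rfl <;> simp_all
    · exfalso
      have h4 := h3
      rw [h1] at h4
      rcases cases hij hjk hik with rfl | rfl | rfl <;> simp_all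
    · refine ⟨v, i, j, k, hij, hjk, hik, h3, h4, h5, h1, h2, fun hk => ?_, fun hk => ?_⟩
      · change kind (Γ.edgeAt v n) = _ at hk
        rcases cases hij hjk hik with rfl | rfl | rfl <;> simp_all
      · change kind (Γ.edgeAt v n) = _ at hk
        rcases cases hij hjk hik with rfl | rfl | rfl <;> simp_all
  · have := h.kind_leafEdge l
    simp_all

theorem partner_halfSum (h : IsCaterpillarShape Γ kind τ) {e : Γ.E} (he : kind e = .halfSum) :
    kind (τ e) = .halfDiff ∧ τ (τ e) = e := by
  obtain ⟨v, i, j, k, -, -, -, -, h1, h2, h3, h4, h5, -⟩ := h.exists_doubled e (Or.inl he)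
  rw [h5 he, h3, h4]
  exact ⟨h2, rfl⟩

theorem partner_halfDiff (h : IsCaterpillarShape Γ kind τ) {e : Γ.E} (he : kind e = .halfDiff) :
    kind (τ e) = .halfSum ∧ τ (τ e) = e := by
  obtain ⟨v, i, j, k, -, -, -, -, h1, h2, h3, h4, -, h5⟩ := h.exists_doubled e (Or.inr he)
  rw [h5 he, h4, h3]
  exact ⟨h1, rfl⟩

theorem coordMap_injective (h : IsCaterpillarShape Γ kind τ) :
    Function.Injective (coordMap kind τ) := by
  rw [injective_iff_map_eq_zero]
  intro z hz
  have hw : ∀ e, coordWeight kind τ z e = 0 := fun e => by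
    have : (coordWeight kind τ z e : ℝ) = 0 := congrFun hz e
    exact_mod_cast this
  ext e
  have h1 := hw e
  have h2 := hw (τ e)
  simp only [coordWeight] at h1 h2
  rw [Pi.zero_apply]
  rcases hk : kind e <;> simp only [hk] at h1
  · omega
  · exact h1
  · obtain ⟨h3, h4⟩ := h.partner_halfSum hk
    simp only [h3, h4] at h2
    omega
  · obtain ⟨h3, h4⟩ := h.partner_halfDiff hk
    simp only [h3, h4] at h2
    omega

theorem coordMap_mem_lattice (h : IsCaterpillarShape Γ kind τ) (z : Γ.E → ℤ) :
    coordMap kind τ z ∈ Γ.lattice := by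
  refine ⟨fun e => ⟨coordWeight kind τ z e, rfl⟩, fun v => ?_⟩
  obtain ⟨ε, hε⟩ := h.exists_parity 0
  have key : 2 ∣ coordWeight kind τ z (Γ.edgeAt v 0) + coordWeight kind τ z (Γ.edgeAt v 1) +
      coordWeight kind τ z (Γ.edgeAt v 2) := by
    rcases hε v with ⟨i, j, k, l, hij, hjk, hik, h1, h2, h3, -⟩ |
      ⟨i, j, k, hij, hjk, hik, h1, h2, h3, -⟩ |
      ⟨i, j, k, hij, hjk, hik, h1, h2, h3, h4, h5, -, -⟩ <;>
    rw [sum_perm (fun i => coordWeight kind τ z (Γ.edgeAt v i)) hij hjk hik]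
    · have h4 := h.kind_leafEdge l
      rw [← h1] at h4
      simp only [coordWeight, h2, h3, h4]
      omega
    · simp only [← h1]
      simp only [coordWeight, h2, h3]
      omega
    · simp only [coordWeight, h1, h2, h3, h4, h5]
      omega
  obtain ⟨c, hc⟩ := key
  refine ⟨c, ?_⟩
  change (coordWeight kind τ z _ : ℝ) + coordWeight kind τ z _ + coordWeight kind τ z _ = _
  exact_mod_cast hc

/-- A lattice point with even leaf weights has integral coordinates. -/
theorem exists_coordMap_eq (h : IsCaterpillarShape Γ kind τ) {w : Γ.E → ℝ} (hw : w ∈ Γ.lattice)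
    (hl : ∀ l, ∃ c : ℤ, w (Γ.leafEdge l) = 2 * c) : ∃ z, coordMap kind τ z = w := by
  choose c hc using hw.1
  have hv : ∀ v, 2 ∣ c (Γ.edgeAt v 0) + c (Γ.edgeAt v 1) + c (Γ.edgeAt v 2) := fun v => by
    obtain ⟨d, hd⟩ := hw.2 v
    rw [hc, hc, hc] at hd
    exact ⟨d, by exact_mod_cast hd⟩
  have hsep := h.even_of_separating c hv fun l => by
    obtain ⟨d, hd⟩ := hl l
    rw [hc] at hd
    exact ⟨d, by exact_mod_cast hd⟩
  have hdbl : ∀ e, kind e = .halfSum ∨ kind e = .halfDiff → 2 ∣ c e + c (τ e) := by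
    intro e he
    obtain ⟨v, i, j, k, hij, hjk, hik, h0, h1, h2, h3, h4, h5, h6⟩ := h.exists_doubled e he
    have h7 := hv v
    rw [sum_perm (fun i => c (Γ.edgeAt v i)) hij hjk hik] at h7
    have h8 := hsep _ h0
    rcases he with he | he
    · rw [h5 he, h3]; omega
    · rw [h6 he, h4]; omega
  refine ⟨fun e => match kind e with
    | .separating => c e / 2
    | .loop => c e
    | .halfSum => (c e + c (τ e)) / 2
    | .halfDiff => (c (τ e) - c e) / 2, funext fun e => ?_⟩
  rw [hc e]
  change (coordWeight kind τ _ e : ℝ) = _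
  norm_cast
  simp only [coordWeight]
  rcases hk : kind e <;> simp only
  · have := hsep e hk
    omega
  · obtain ⟨h3, h4⟩ := h.partner_halfSum hk
    have := hdbl e (Or.inl hk)
    simp only [h3, h4]
    omega
  · obtain ⟨h3, h4⟩ := h.partner_halfDiff hk
    have := hdbl e (Or.inr hk)
    simp only [h3, h4]
    omega

/-- Rounding splits the integer points of the dilates of the polytope: at each trinode, the facet
inequalities bound a coordinate, or a sum or difference of two coordinates by a constant of the
right parity. -/
theorem split (h : IsCaterpillarShape Γ kind τ) {r : Γ.Leaf → ℕ} {L m : ℕ} {ε : Γ.E → ℤ}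
    (hε : ∀ v, TrinodeShape Γ kind τ r ε v) {z x : Γ.E → ℤ}
    (hz : coordMap kind τ z ∈ Γ.polytope (fun l => (m + 1) * (2 * r l)) ((m + 1) * (2 * L)))
    (hx : ∀ e, IsRounding (ε e) (m + 1) (z e) (x e)) :
    coordMap kind τ x ∈ Γ.polytope (fun l => 2 * r l) (2 * L) ∧
      coordMap kind τ (z - x) ∈ Γ.polytope (fun l => m * (2 * r l)) (m * (2 * L)) := by
  have h1 := (intCast_mem_polytope_iff (coordWeight kind τ z) _ _).1 hz
  obtain ⟨hv, hl⟩ := h1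
  have leafWeight : ∀ z l, coordWeight kind τ z (Γ.leafEdge l) = 2 * z (Γ.leafEdge l) := fun z l => by
    simp only [coordWeight, h.kind_leafEdge l]
  have hzl : ∀ l, z (Γ.leafEdge l) = (m + 1) * r l := fun l => by
    have := hl l
    rw [leafWeight] at this
    push_cast at this
    linarith
  have hxl : ∀ l, x (Γ.leafEdge l) = r l := fun l => by
    have h1 := (hx (Γ.leafEdge l)).le (hzl l).le
    have h2 := (hx (Γ.leafEdge l)).neg.le (c := -(r l : ℤ)) (by rw [hzl l]; linarith)
    exact le_antisymm h1.1 (by linarith [h2.1])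
  have key : ∀ v, IsTriangle (coordWeight kind τ x (Γ.edgeAt v 0))
        (coordWeight kind τ x (Γ.edgeAt v 1)) (coordWeight kind τ x (Γ.edgeAt v 2))
        (2 * (2 * L)) ∧ IsTriangle (coordWeight kind τ (z - x) (Γ.edgeAt v 0))
        (coordWeight kind τ (z - x) (Γ.edgeAt v 1)) (coordWeight kind τ (z - x) (Γ.edgeAt v 2))
        (2 * (m * (2 * L))) := by
    intro v
    have hvv := hv v
    push_cast at hvv
    rcases hε v with ⟨i, j, k, l, hij, hjk, hik, h1, h2, h3, h4⟩ |
      ⟨i, j, k, hij, hjk, hik, h1, h2, h3, h4⟩ |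
      ⟨i, j, k, hij, hjk, hik, h1, h2, h3, h4, h5, h6, h7⟩ <;>
    rw [isTriangle_perm (fun i => coordWeight kind τ _ (Γ.edgeAt v i)) _ hij hjk hik] at hvv ⊢ <;>
    rw [isTriangle_perm (fun i => coordWeight kind τ (z - x) (Γ.edgeAt v i)) _ hij hjk hik]
    -- two separating edges and a leaf edge: the sum and the difference of the coordinates are
    -- bounded in terms of the leaf weight
    · simp only [h1, leafWeight] at hvv ⊢
      simp only [coordWeight, h2, h3, hzl, hxl, Pi.sub_apply] at hvv ⊢
      obtain ⟨a1, a2, a3, a4⟩ := hvv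
      have hi := hx (Γ.edgeAt v i)
      have hj := hx (Γ.edgeAt v j)
      have b1 := hi.add_le hj.neg (c := r l) (by omega) (by linarith)
      have b2 := hi.neg.add_le hj (c := r l) (by omega) (by linarith)
      have b3 := hi.neg.add_le hj.neg (c := -r l) (by omega) (by linarith)
      have b4 := hi.add_le hj (c := 2 * L - r l) (by omega) (by linarith)
      refine ⟨⟨?_, ?_, ?_, ?_⟩, ⟨?_, ?_, ?_, ?_⟩⟩ <;> linarith
    -- a loop: its weight is at least the coordinate of the third edge
    · simp only [← h1] at hvv ⊢
      simp only [coordWeight, h2, h3, Pi.sub_apply] at hvv ⊢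
      obtain ⟨a1, a2, a3, a4⟩ := hvv
      have hi := hx (Γ.edgeAt v i)
      have hj := hx (Γ.edgeAt v j)
      have b1 := hi.add_le hj.neg (c := 0) (by omega) (by linarith)
      have b2 := hi.neg.le (c := 0) (by linarith)
      have b4 := hi.add_le hj (c := 2 * L) (by omega) (by linarith)
      refine ⟨⟨?_, ?_, ?_, ?_⟩, ⟨?_, ?_, ?_, ?_⟩⟩ <;> linarith
    -- a doubled edge: the coordinate of the third edge lies between the absolute value of the half
    -- difference and the half sum
    · simp only [coordWeight, h1, h2, h3, h4, h5, Pi.sub_apply] at hvv ⊢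
      obtain ⟨a1, a2, a3, a4⟩ := hvv
      have hi := hx (Γ.edgeAt v i)
      have hj := hx (Γ.edgeAt v j)
      have hk := hx (Γ.edgeAt v k)
      have b1 := hi.add_le hj.neg (c := 0) (by omega) (by linarith)
      have b2 := hk.add_le hi.neg (c := 0) (by omega) (by linarith)
      have b3 := hk.neg.add_le hi.neg (c := 0) (by omega) (by linarith)
      have b4 := hi.add_le hj (c := 2 * L) (by omega) (by linarith)
      refine ⟨⟨?_, ?_, ?_, ?_⟩, ⟨?_, ?_, ?_, ?_⟩⟩ <;> linarith
  constructor
  · refine (intCast_mem_polytope_iff (coordWeight kind τ x) _ _).2 ⟨fun v => ?_, fun l => ?_⟩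
    · push_cast; exact (key v).1
    · rw [leafWeight, hxl]; push_cast; ring
  · refine (intCast_mem_polytope_iff (coordWeight kind τ (z - x)) _ _).2
      ⟨fun v => ?_, fun l => ?_⟩
    · push_cast; exact (key v).2
    · rw [leafWeight, Pi.sub_apply, hzl, hxl]; push_cast; ring

theorem alcovedCoordinates (h : IsCaterpillarShape Γ kind τ) (r : Γ.Leaf → ℕ) (L : ℕ) :
    ∃ ε, LatticePolytope.AlcovedCoordinates Γ.lattice (Γ.polytope (fun l => 2 * r l) (2 * L))
      (coordMap kind τ) (fun m => {z | coordMap kind τ z ∈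
        Γ.polytope (fun l => m * (2 * r l)) (m * (2 * L))}) ε := by
  obtain ⟨ε, hε⟩ := h.exists_parity r
  refine ⟨ε, h.coordMap_injective, fun m x hM hx => ?_, fun z _ => h.coordMap_mem_lattice z,
    fun z hz => by simpa using hz, fun m _ z hz x hx => ?_⟩
  · have hx' := minkowskiSum_polytope_subset _ _ _ hx
    obtain ⟨z, rfl⟩ := h.exists_coordMap_eq hM fun l =>
      ⟨m * r l, by rw [hx'.2.2.2 l]; push_cast; ring⟩
    exact ⟨z, hx', rfl⟩
  · have := h.split hε hz hx
    exact ⟨by simpa using this.1, this.2⟩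

end IsCaterpillarShape

end TrivalentGraph

namespace TrivalentGraph

variable {Γ : TrivalentGraph}

/-! ### Cuts at separating edges -/

/-- Every colouring of the vertices that is constant along all edges is constant; here `c` is the
common colour of the two ends of an edge. -/
def HasOnlyConstantColorings (Γ : TrivalentGraph) : Prop :=
  ∀ (f : Γ.V ⊕ Γ.Leaf → Bool) (c : Γ.E → Bool), (∀ h, f (Γ.base h) = c (Γ.attach h)) →
    ∀ x y, f x = f y

/-- There is a two-colouring of the vertices for which `e` is the only edge whose ends have
different colours. -/
def HasCut (Γ : TrivalentGraph) (e : Γ.E) : Prop :=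
  ∃ (f : Γ.V ⊕ Γ.Leaf → Bool) (c : Γ.E → Bool),
    (∀ h, Γ.attach h ≠ e → f (Γ.base h) = c (Γ.attach h)) ∧
    ∀ h k, Γ.attach h = e → Γ.attach k = e → h ≠ k → f (Γ.base h) ≠ f (Γ.base k)

theorem IsConnected.hasOnlyConstantColorings (hΓ : Γ.IsConnected) :
    Γ.HasOnlyConstantColorings := by
  intro f c hf x y
  obtain ⟨p⟩ := hΓ.preconnected x y
  induction p with
  | nil => rfl
  | cons hadj _ ih =>
    refine Eq.trans ?_ ih
    obtain ⟨-, ⟨h, k, hhk, -, rfl, rfl⟩ | ⟨h, k, hhk, -, rfl, rfl⟩⟩ := hadj <;>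
    rw [hf, hf, hhk]

theorem HasOnlyConstantColorings.hasCut (hΓ : Γ.HasOnlyConstantColorings) {e : Γ.E}
    (he : Γ.IsSeparating e) : Γ.HasCut e := by
  classical
  have hne : Nonempty (Γ.V ⊕ Γ.Leaf) := ⟨Γ.base (Γ.exists_halfEdge e).choose⟩
  obtain ⟨x, y, hxy⟩ : ∃ x y, ¬ (Γ.deleteEdges {e}).Reachable x y := by
    by_contra! H
    exact he ⟨H⟩
  let f : Γ.V ⊕ Γ.Leaf → Bool := fun u => decide ((Γ.deleteEdges {e}).Reachable x u)
  have hf : ∀ h k, Γ.attach h = Γ.attach k → Γ.attach h ≠ e → f (Γ.base h) = f (Γ.base k) := by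
    intro h k hhk hh
    by_cases hb : Γ.base h = Γ.base k
    · rw [hb]
    have hadj : (Γ.deleteEdges {e}).Adj (Γ.base h) (Γ.base k) :=
      ⟨hb, Or.inl ⟨h, k, hhk, hh, rfl, rfl⟩⟩
    simp only [f, decide_eq_decide]
    exact ⟨fun hr => hr.trans hadj.reachable, fun hr => hr.trans hadj.symm.reachable⟩
  refine ⟨f, fun d => f (Γ.base (Γ.exists_halfEdge d).choose),
    fun h hh => hf _ _ (Γ.exists_halfEdge _).choose_spec.symm hh, ?_⟩
  intro h k hh hk hne hhk
  obtain ⟨p, q, -, H⟩ := Γ.two_ends e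
  have hall : ∀ g, Γ.attach g = e → f (Γ.base g) = f (Γ.base h) := by
    intro g hg
    have h1 := (H h).1 hh
    have h2 := (H k).1 hk
    have h3 := (H g).1 hg
    rcases h1 with rfl | rfl <;> rcases h2 with rfl | rfl <;> rcases h3 with rfl | rfl <;>
      first | rfl | exact hhk.symm | exact absurd rfl hne
  -- otherwise the colouring would be constant along `e`, too, and hence constant
  have := hΓ f (fun d => f (Γ.base (Γ.exists_halfEdge d).choose)) (fun g => ?_) x y
  · have hx : f x = true := decide_eq_true (SimpleGraph.Reachable.refl x)
    have hy : f y = false := decide_eq_false hxy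
    rw [hx, hy] at this
    exact absurd this (by decide)
  · have hspec := (Γ.exists_halfEdge (Γ.attach g)).choose_spec
    by_cases hg : Γ.attach g = e
    · rw [hall g hg, hall _ (hspec.trans hg)]
    · exact hf _ _ hspec.symm hg

/-- The cut at an edge that contains the half-edge `h₀`, coloured so that `h₀` lies on the side of
the colour `false`. -/
theorem HasCut.exists_of_halfEdge {e : Γ.E} (he : Γ.HasCut e) {h₀ : Γ.HalfEdge}
    (h₀e : Γ.attach h₀ = e) : ∃ (f : Γ.V ⊕ Γ.Leaf → Bool) (c : Γ.E → Bool),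
      (∀ h, Γ.attach h ≠ e → f (Γ.base h) = c (Γ.attach h)) ∧ f (Γ.base h₀) = false ∧
      ∀ h, Γ.attach h = e → h ≠ h₀ → f (Γ.base h) = true := by
  obtain ⟨f, c, h1, h2⟩ := he
  refine ⟨fun x => f x ^^ f (Γ.base h₀), fun d => c d ^^ f (Γ.base h₀), fun h hh =>
    congrArg (fun b => b ^^ f (Γ.base h₀)) (h1 h hh), by simp, fun h hh hne => ?_⟩
  have := h2 h h₀ hh h₀e hne
  cases h3 : f (Γ.base h) <;> cases h4 : f (Γ.base h₀) <;> simp_all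

/-- An integral weighting with even sums at the trinodes and even leaf weights is even at an edge
with a cut: add up the weights on one side of the cut. -/
theorem HasCut.even {e : Γ.E} (he : Γ.HasCut e) (k : Γ.E → ℤ)
    (hv : ∀ v, 2 ∣ k (Γ.edgeAt v 0) + k (Γ.edgeAt v 1) + k (Γ.edgeAt v 2))
    (hl : ∀ l, 2 ∣ k (Γ.leafEdge l)) : 2 ∣ k e := by
  classical
  have := Γ.finite_V
  have := Γ.finite_E
  have := Γ.finite_Leaf
  have := Fintype.ofFinite Γ.V
  have := Fintype.ofFinite Γ.E
  have := Fintype.ofFinite Γ.Leaf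
  obtain ⟨f, c, h1, h2⟩ := he
  have two : ∀ x : ZMod 2, x + x = 0 := by decide
  refine (ZMod.intCast_zmod_eq_zero_iff_dvd (k e) 2).1 ?_
  let F : Γ.HalfEdge → ZMod 2 := fun h => if f (Γ.base h) then (k (Γ.attach h) : ZMod 2) else 0
  -- the half-edges of the colour `true`, grouped by their vertices and then by their edges
  have s1 : ∑ h, F h = 0 := by
    rw [Fintype.sum_sum_type, Fintype.sum_prod_type, Finset.sum_eq_zero, Finset.sum_eq_zero,
      add_zero]
    · intro l _
      have := (ZMod.intCast_zmod_eq_zero_iff_dvd _ 2).2 (hl l)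
      simp only [F]
      split_ifs
      · exact this
      · rfl
    · intro v _
      have := (ZMod.intCast_zmod_eq_zero_iff_dvd _ 2).2 (hv v)
      push_cast at this
      have hF : ∀ i, F (Sum.inl (v, i)) =
          if f (Sum.inl v) then (k (Γ.edgeAt v i) : ZMod 2) else 0 := fun _ => rfl
      rw [Fin.sum_univ_three, hF, hF, hF]
      cases f (Sum.inl v)
      · simp
      · exact this
  have s2 : ∑ h, F h = ∑ d, if d = e then (k e : ZMod 2) else 0 := by
    rw [← Finset.sum_fiberwise Finset.univ Γ.attach F]
    refine Finset.sum_congr rfl fun d _ => ?_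
    obtain ⟨p, q, hpq, H⟩ := Γ.two_ends d
    have hfil : Finset.univ.filter (fun h => Γ.attach h = d) = {p, q} := by
      ext h; simp [H]
    have hp : Γ.attach p = d := (H p).2 (Or.inl rfl)
    have hq : Γ.attach q = d := (H q).2 (Or.inr rfl)
    rw [hfil, Finset.sum_pair hpq]
    simp only [F, hp, hq]
    by_cases hd : d = e
    · subst hd
      have := h2 p q hp hq hpq
      cases h3 : f (Γ.base p) <;> cases h4 : f (Γ.base q) <;> simp_all
    · rw [if_neg hd, h1 p (by rwa [hp]), h1 q (by rwa [hq]), hp, hq]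
      exact two _
  rw [s1, Finset.sum_ite_eq' Finset.univ e] at s2
  simpa using s2.symm

/-- An edge with a cut at a trinode `v` gives a function on the edges that separates this edge from
the other edges at `v`, but is constant around every other trinode: the indicator function of the
far side of the cut. -/
theorem HasCut.exists_indicator {v : Γ.V} {j : Fin 3} (he : Γ.HasCut (Γ.edgeAt v j)) :
    ∃ η : Γ.E → ℤ, (∀ u, u ≠ v → ∀ i i', η (Γ.edgeAt u i) = η (Γ.edgeAt u i')) ∧
      η (Γ.edgeAt v j) = 1 ∧ ∀ i, i ≠ j → η (Γ.edgeAt v i) = 0 := by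
  classical
  obtain ⟨f, c, h1, h2, h3⟩ := he.exists_of_halfEdge (h₀ := Sum.inl (v, j)) rfl
  let η : Γ.E → ℤ := fun e => if e = Γ.edgeAt v j ∨ c e = true then 1 else 0
  have far : ∀ u i, f (Sum.inl u) = true → η (Γ.edgeAt u i) = 1 := by
    intro u i hu
    refine if_pos ?_
    by_cases h : Γ.edgeAt u i = Γ.edgeAt v j
    · exact Or.inl h
    · exact Or.inr ((h1 (Sum.inl (u, i)) h).symm.trans hu)
  have near : ∀ u i, f (Sum.inl u) = false → ¬ (u = v ∧ i = j) → η (Γ.edgeAt u i) = 0 := by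
    intro u i hu hne
    have h : Γ.edgeAt u i ≠ Γ.edgeAt v j := by
      intro h
      have := h3 (Sum.inl (u, i)) h (by simpa using hne)
      exact absurd (hu.symm.trans this) (by decide)
    refine if_neg ?_
    have := (h1 (Sum.inl (u, i)) h).symm.trans hu
    rw [not_or, Bool.not_eq_true]
    exact ⟨h, this⟩
  refine ⟨η, fun u hu i i' => ?_, if_pos (Or.inl rfl), fun i hi => near v i h2 (by simp [hi])⟩
  cases hfu : f (Sum.inl u)
  · rw [near u i hfu (by simp [hu]), near u i' hfu (by simp [hu])]
  · rw [far u i hfu, far u i' hfu]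

/-! ### Trinodes and edges of graphs obtained from a tree -/

/-- The roles of the edges of a graph that arises from a tree: separating edges have cuts, and a
trinode is one of the tree, or carries a loop, or is one of the two ends of a doubled edge. -/
structure EdgeRoles (Γ : TrivalentGraph) (tree : Set Γ.V) (kind : Γ.E → EdgeKind)
    (τ : Γ.E → Γ.E) : Prop where
  connected : Γ.HasOnlyConstantColorings
  hasCut : ∀ e, kind e = .separating → Γ.HasCut e
  kind_leafEdge : ∀ l, kind (Γ.leafEdge l) = .separating
  trinode : ∀ v, (v ∈ tree ∧ ∀ i, kind (Γ.edgeAt v i) = .separating) ∨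
    (∃ i j k : Fin 3, i ≠ j ∧ j ≠ k ∧ i ≠ k ∧ Γ.edgeAt v j = Γ.edgeAt v k ∧
      kind (Γ.edgeAt v i) = .separating ∧ kind (Γ.edgeAt v j) = .loop) ∨
    ∃ i j k : Fin 3, i ≠ j ∧ j ≠ k ∧ i ≠ k ∧ τ (Γ.edgeAt v j) = Γ.edgeAt v k ∧
      τ (Γ.edgeAt v k) = Γ.edgeAt v j ∧ kind (Γ.edgeAt v i) = .separating ∧
      kind (Γ.edgeAt v j) = .halfSum ∧ kind (Γ.edgeAt v k) = .halfDiff ∧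
      ∃ u, u ≠ v ∧ ∃ j' k', Γ.edgeAt u j' = Γ.edgeAt v j ∧ Γ.edgeAt u k' = Γ.edgeAt v k

theorem EdgeRoles.of_isTree (hΓ : Γ.IsTree) :
    Γ.EdgeRoles Set.univ (fun _ => .separating) id where
  connected := hΓ.1.hasOnlyConstantColorings
  hasCut e _ := hΓ.1.hasOnlyConstantColorings.hasCut (hΓ.2 e)
  kind_leafEdge _ := rfl
  trinode v := Or.inl ⟨Set.mem_univ v, fun _ => rfl⟩

theorem not_hasCut_of_loop {v : Γ.V} {j k : Fin 3} (hjk : j ≠ k)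
    (h : Γ.edgeAt v j = Γ.edgeAt v k) : ¬ Γ.HasCut (Γ.edgeAt v j) := by
  rintro ⟨f, c, -, h2⟩
  exact h2 (Sum.inl (v, j)) (Sum.inl (v, k)) rfl h.symm (by simpa using hjk) rfl

/-- A cut at one edge of a doubled edge would be crossed by the other edge as well. -/
theorem not_hasCut_of_doubled {u v : Γ.V} {j k j' k' : Fin 3} (huv : u ≠ v)
    (hne : Γ.edgeAt v j ≠ Γ.edgeAt v k) (hj : Γ.edgeAt u j' = Γ.edgeAt v j)
    (hk : Γ.edgeAt u k' = Γ.edgeAt v k) : ¬ Γ.HasCut (Γ.edgeAt v j) := by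
  rintro ⟨f, c, h1, h2⟩
  refine h2 (Sum.inl (u, j')) (Sum.inl (v, j)) hj rfl (by simp [huv]) ?_
  have h3 := h1 (Sum.inl (v, k)) hne.symm
  have h4 := h1 (Sum.inl (u, k')) (by rw [← hk] at hne; exact hne.symm)
  exact h4.trans ((congrArg c hk).trans h3.symm)

/-- Loops and the edges of a doubled edge have no cut. -/
theorem EdgeRoles.kind_eq_of_hasCut {tree : Set Γ.V} {kind : Γ.E → EdgeKind} {τ : Γ.E → Γ.E}
    (h : Γ.EdgeRoles tree kind τ) {e : Γ.E} (he : Γ.HasCut e) : kind e = .separating := by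
  obtain ⟨⟨v, n⟩ | l, rfl⟩ := Γ.exists_halfEdge e
  · change Γ.HasCut (Γ.edgeAt v n) at he
    change kind (Γ.edgeAt v n) = _
    rcases h.trinode v with ⟨-, h1⟩ | ⟨i, j, k, hij, hjk, hik, h1, h2, -⟩ |
      ⟨i, j, k, hij, hjk, hik, -, -, h2, h3, h4, u, hu, j', k', hj, hk⟩
    · exact h1 n
    · rcases eq_or_eq_or_eq n hij hjk hik with rfl | rfl | rfl
      · exact h2
      · exact absurd he (not_hasCut_of_loop hjk h1)
      · exact absurd he (not_hasCut_of_loop hjk.symm h1.symm)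
    · have hne : Γ.edgeAt v j ≠ Γ.edgeAt v k := fun h => by
        rw [h, h4] at h3; exact absurd h3 (by simp)
      rcases eq_or_eq_or_eq n hij hjk hik with rfl | rfl | rfl
      · exact h2
      · exact absurd he (not_hasCut_of_doubled hu hne hj hk)
      · exact absurd he (not_hasCut_of_doubled hu hne.symm hk hj)
  · exact h.kind_leafEdge l

/-! ### Attaching a loop -/

section AddLoop

variable (l : Γ.Leaf)

open Classical in
/-- The half-edges of `Γ` as half-edges of `Γ.addLoop l`. -/
noncomputable def addLoopHalfEdge : Γ.HalfEdge → (Γ.addLoop l).HalfEdge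
  | Sum.inl (v, i) => Sum.inl (some v, i)
  | Sum.inr m => if hm : m = l then Sum.inl (none, 0) else Sum.inr ⟨m, hm⟩

/-- A colouring of the vertices of `Γ` as a colouring of the vertices of `Γ.addLoop l`. -/
def addLoopColoring (f : Γ.V ⊕ Γ.Leaf → Bool) :
    (Γ.addLoop l).V ⊕ (Γ.addLoop l).Leaf → Bool
  | Sum.inl (some v) => f (Sum.inl v)
  | Sum.inl none => f (Sum.inr l)
  | Sum.inr m => f (Sum.inr m.1)

theorem attach_addLoopHalfEdge (h : Γ.HalfEdge) :
    (Γ.addLoop l).attach (addLoopHalfEdge l h) = some (Γ.attach h) := by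
  rcases h with ⟨v, i⟩ | m
  · rfl
  · simp only [addLoopHalfEdge]
    split_ifs with hm
    · subst hm; rfl
    · rfl

theorem addLoopColoring_base (f : Γ.V ⊕ Γ.Leaf → Bool) (h : Γ.HalfEdge) :
    addLoopColoring l f ((Γ.addLoop l).base (addLoopHalfEdge l h)) = f (Γ.base h) := by
  rcases h with ⟨v, i⟩ | m
  · rfl
  · simp only [addLoopHalfEdge]
    split_ifs with hm
    · subst hm; rfl
    · rfl

theorem addLoop_halfEdge_cases (h' : (Γ.addLoop l).HalfEdge) :
    (∃ h, h' = addLoopHalfEdge l h) ∨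
      ((Γ.addLoop l).attach h' = none ∧ (Γ.addLoop l).base h' = Sum.inl none) := by
  rcases h' with ⟨_ | v, i⟩ | m
  · fin_cases i
    · exact Or.inl ⟨Sum.inr l, by simp [addLoopHalfEdge]⟩
    · exact Or.inr ⟨rfl, rfl⟩
    · exact Or.inr ⟨rfl, rfl⟩
  · exact Or.inl ⟨Sum.inl (v, i), rfl⟩
  · exact Or.inl ⟨Sum.inr m.1, by simp [addLoopHalfEdge, m.2]; rfl⟩

theorem HasOnlyConstantColorings.addLoop (hΓ : Γ.HasOnlyConstantColorings) :
    (Γ.addLoop l).HasOnlyConstantColorings := by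
  classical
  intro f c hf
  let u : Γ.V ⊕ Γ.Leaf → (Γ.addLoop l).V ⊕ (Γ.addLoop l).Leaf
    | Sum.inl v => Sum.inl (some v)
    | Sum.inr m => if hm : m = l then Sum.inl none else Sum.inr ⟨m, hm⟩
  have hu : ∀ h, (Γ.addLoop l).base (addLoopHalfEdge l h) = u (Γ.base h) := by
    rintro (⟨v, i⟩ | m)
    · rfl
    · simp only [addLoopHalfEdge, u, base, Sum.map_inr, id]
      split_ifs <;> rfl
  have hsurj : Function.Surjective u := by
    rintro ((_ | v) | m)
    · exact ⟨Sum.inr l, by simp [u]⟩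
    · exact ⟨Sum.inl v, rfl⟩
    · exact ⟨Sum.inr m.1, by simp [u, m.2]; rfl⟩
  have key := hΓ (fun x => f (u x)) (fun e => c (some e)) fun h => by
    rw [← hu, hf, attach_addLoopHalfEdge]
  intro x y
  obtain ⟨x, rfl⟩ := hsurj x
  obtain ⟨y, rfl⟩ := hsurj y
  exact key x y

theorem HasCut.addLoop {e : Γ.E} (he : Γ.HasCut e) : (Γ.addLoop l).HasCut (some e) := by
  obtain ⟨f, c, h1, h2⟩ := he
  refine ⟨addLoopColoring l f, fun d => d.elim (f (Sum.inr l)) c, fun h' hh => ?_,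
    fun h' k' hh hk hne => ?_⟩
  · rcases addLoop_halfEdge_cases l h' with ⟨h, rfl⟩ | ⟨ha, hb⟩
    · rw [attach_addLoopHalfEdge] at hh ⊢
      rw [addLoopColoring_base]
      exact h1 h fun h3 => hh (congrArg some h3)
    · rw [ha, hb]; rfl
  · rcases addLoop_halfEdge_cases l h' with ⟨h, rfl⟩ | ⟨ha, -⟩
    · rcases addLoop_halfEdge_cases l k' with ⟨k, rfl⟩ | ⟨ka, -⟩
      · rw [attach_addLoopHalfEdge] at hh hk
        rw [addLoopColoring_base, addLoopColoring_base]
        exact h2 h k (Option.some_injective _ hh) (Option.some_injective _ hk)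
          fun h3 => hne (by rw [h3])
      · rw [ka] at hk; exact absurd hk (by simp)
    · rw [ha] at hh; exact absurd hh (by simp)

theorem EdgeRoles.addLoop {tree : Set Γ.V} {kind : Γ.E → EdgeKind} {τ : Γ.E → Γ.E}
    (h : Γ.EdgeRoles tree kind τ) {tree' : Set (Γ.addLoop l).V}
    (htree : ∀ v ∈ tree, (some v : Option Γ.V) ∈ tree') :
    (Γ.addLoop l).EdgeRoles tree' (fun e : Option Γ.E => e.elim .loop kind)
      (Option.map τ) where
  connected := h.connected.addLoop l
  hasCut e he := by
    rcases e with _ | e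
    · exact absurd he (by simp)
    · exact (h.hasCut e he).addLoop l
  kind_leafEdge m := h.kind_leafEdge m.1
  trinode v := by
    rcases v with _ | v
    · exact Or.inr (Or.inl ⟨0, 1, 2, by decide, by decide, by decide, rfl, h.kind_leafEdge l, rfl⟩)
    · rcases h.trinode v with ⟨h0, h1⟩ | ⟨i, j, k, hij, hjk, hik, h1, h2, h3⟩ |
        ⟨i, j, k, hij, hjk, hik, h0, h1, h2, h3, h4, u, hu, j', k', hj, hk⟩
      · exact Or.inl ⟨htree v h0, h1⟩
      · exact Or.inr (Or.inl ⟨i, j, k, hij, hjk, hik, congrArg some h1, h2, h3⟩)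
      · exact Or.inr (Or.inr ⟨i, j, k, hij, hjk, hik, congrArg some h0, congrArg some h1, h2, h3,
          h4, some u, fun h5 => hu (Option.some_injective _ h5), j', k', congrArg some hj,
          congrArg some hk⟩)

end AddLoop

/-! ### Inserting a doubled edge -/

section AddDoubledEdge

variable (h₀ : Γ.HalfEdge)

/-- The half-edges of `Γ` as half-edges of `Γ.addDoubledEdge h₀`. -/
def addDoubledEdgeHalfEdge : Γ.HalfEdge → (Γ.addDoubledEdge h₀).HalfEdge
  | Sum.inl (v, i) => Sum.inl (Sum.inl v, i)
  | Sum.inr m => Sum.inr m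

/-- The extension of a colouring of the vertices of `Γ` that takes the value `b` at the two new
vertices of `Γ.addDoubledEdge h₀`. -/
def addDoubledEdgeColoring (f : Γ.V ⊕ Γ.Leaf → Bool) (b : Bool) :
    (Γ.addDoubledEdge h₀).V ⊕ (Γ.addDoubledEdge h₀).Leaf → Bool
  | Sum.inl (Sum.inl v) => f (Sum.inl v)
  | Sum.inl (Sum.inr _) => b
  | Sum.inr m => f (Sum.inr m)

theorem attach_addDoubledEdgeHalfEdge_self :
    (Γ.addDoubledEdge h₀).attach (addDoubledEdgeHalfEdge h₀ h₀) = Sum.inr 0 := by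
  rcases h₀ with ⟨v, i⟩ | m
  · exact if_pos rfl
  · exact if_pos rfl

theorem attach_addDoubledEdgeHalfEdge {h : Γ.HalfEdge} (hne : h ≠ h₀) :
    (Γ.addDoubledEdge h₀).attach (addDoubledEdgeHalfEdge h₀ h) = Sum.inl (Γ.attach h) := by
  rcases h with ⟨v, i⟩ | m
  · exact if_neg hne
  · exact if_neg hne

theorem addDoubledEdgeColoring_base (f : Γ.V ⊕ Γ.Leaf → Bool) (b : Bool) (h : Γ.HalfEdge) :
    addDoubledEdgeColoring h₀ f b ((Γ.addDoubledEdge h₀).base (addDoubledEdgeHalfEdge h₀ h)) =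
      f (Γ.base h) := by
  rcases h with ⟨v, i⟩ | m <;> rfl

theorem addDoubledEdge_halfEdge_cases (h' : (Γ.addDoubledEdge h₀).HalfEdge) :
    h' = addDoubledEdgeHalfEdge h₀ h₀ ∨ (∃ h, h ≠ h₀ ∧ h' = addDoubledEdgeHalfEdge h₀ h) ∨
      h' = Sum.inl (Sum.inr false, 0) ∨ ∃ b i, h' = Sum.inl (Sum.inr b, i) ∧
        (Γ.addDoubledEdge h₀).attach h' = Sum.inr i := by
  have key : ∀ h, h' = addDoubledEdgeHalfEdge h₀ h → h' = addDoubledEdgeHalfEdge h₀ h₀ ∨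
      ∃ h, h ≠ h₀ ∧ h' = addDoubledEdgeHalfEdge h₀ h := by
    intro h hh
    by_cases h1 : h = h₀
    · exact Or.inl (by rw [hh, h1])
    · exact Or.inr ⟨h, h1, hh⟩
  rcases h' with ⟨v | b, i⟩ | m
  · rcases key (Sum.inl (v, i)) rfl with h | h
    · exact Or.inl h
    · exact Or.inr (Or.inl h)
  · rcases b with _ | _
    · fin_cases i
      · exact Or.inr (Or.inr (Or.inl rfl))
      · exact Or.inr (Or.inr (Or.inr ⟨false, 1, rfl, rfl⟩))
      · exact Or.inr (Or.inr (Or.inr ⟨false, 2, rfl, rfl⟩))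
    · exact Or.inr (Or.inr (Or.inr ⟨true, i, rfl, rfl⟩))
  · rcases key (Sum.inr m) rfl with h | h
    · exact Or.inl h
    · exact Or.inr (Or.inl h)

theorem HasOnlyConstantColorings.addDoubledEdge (hΓ : Γ.HasOnlyConstantColorings) :
    (Γ.addDoubledEdge h₀).HasOnlyConstantColorings := by
  intro f c hf
  let u : Γ.V ⊕ Γ.Leaf → (Γ.addDoubledEdge h₀).V ⊕ (Γ.addDoubledEdge h₀).Leaf
    | Sum.inl v => Sum.inl (Sum.inl v)
    | Sum.inr m => Sum.inr m
  have hu : ∀ h, (Γ.addDoubledEdge h₀).base (addDoubledEdgeHalfEdge h₀ h) = u (Γ.base h) := by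
    rintro (⟨v, i⟩ | m) <;> rfl
  -- all pieces of the subdivided edge have the same colour
  have e1 : f (Sum.inl (Sum.inr false)) = c (Sum.inr 1) := hf (Sum.inl (Sum.inr false, 1))
  have e2 : f (Sum.inl (Sum.inr true)) = c (Sum.inr 1) := hf (Sum.inl (Sum.inr true, 1))
  have e3 : f (Sum.inl (Sum.inr true)) = c (Sum.inr 0) := hf (Sum.inl (Sum.inr true, 0))
  have e4 : f (Sum.inl (Sum.inr false)) = c (Sum.inl (Γ.attach h₀)) :=
    hf (Sum.inl (Sum.inr false, 0))
  have e5 : f (u (Γ.base h₀)) = c (Sum.inr 0) := by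
    rw [← hu, hf, attach_addDoubledEdgeHalfEdge_self]
  have key := hΓ (fun x => f (u x)) (fun e => c (Sum.inl e)) fun h => by
    by_cases hne : h = h₀
    · rw [hne, e5, ← e3, e2, ← e1, e4]
    · rw [← hu, hf, attach_addDoubledEdgeHalfEdge h₀ hne]
  have key' : ∀ x, f x = f (u (Γ.base h₀)) := by
    rintro ((v | b) | m)
    · exact key (Sum.inl v) _
    · rcases b with _ | _
      · rw [e1, ← e2, e3, e5]
      · rw [e3, e5]
    · exact key (Sum.inr m) _
  intro x y
  rw [key' x, key' y]

theorem HasCut.addDoubledEdge {e : Γ.E} (he : Γ.HasCut e) :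
    (Γ.addDoubledEdge h₀).HasCut (Sum.inl e) := by
  obtain ⟨f, c, h1, h2⟩ := he
  refine ⟨addDoubledEdgeColoring h₀ f (f (Γ.base h₀)),
    Sum.elim c (fun _ => f (Γ.base h₀)), fun h' hh => ?_, fun h' k' hh hk hne => ?_⟩
  · rcases addDoubledEdge_halfEdge_cases h₀ h' with rfl | ⟨h, hne, rfl⟩ | rfl | ⟨b, i, rfl, hi⟩
    · rw [addDoubledEdgeColoring_base, attach_addDoubledEdgeHalfEdge_self]; rfl
    · rw [attach_addDoubledEdgeHalfEdge h₀ hne] at hh ⊢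
      rw [addDoubledEdgeColoring_base]
      exact h1 h fun h3 => hh (congrArg Sum.inl h3)
    · exact h1 h₀ fun h3 => hh (congrArg Sum.inl h3)
    · rw [hi]; rfl
  · rcases addDoubledEdge_halfEdge_cases h₀ h' with rfl | ⟨h, hn, rfl⟩ | rfl | ⟨b, i, rfl, hi⟩
    · rw [attach_addDoubledEdgeHalfEdge_self] at hh; exact absurd hh (by simp)
    · rw [attach_addDoubledEdgeHalfEdge h₀ hn] at hh
      rw [addDoubledEdgeColoring_base]
      rcases addDoubledEdge_halfEdge_cases h₀ k' with rfl | ⟨k, kn, rfl⟩ | rfl | ⟨b, i, rfl, hi⟩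
      · rw [attach_addDoubledEdgeHalfEdge_self] at hk; exact absurd hk (by simp)
      · rw [attach_addDoubledEdgeHalfEdge h₀ kn] at hk
        rw [addDoubledEdgeColoring_base]
        exact h2 h k (Sum.inl_injective hh) (Sum.inl_injective hk) fun h3 => hne (by rw [h3])
      · exact h2 h h₀ (Sum.inl_injective hh) (Sum.inl_injective hk) hn
      · rw [hi] at hk; exact absurd hk (by simp)
    · rcases addDoubledEdge_halfEdge_cases h₀ k' with rfl | ⟨k, kn, rfl⟩ | rfl | ⟨b, i, rfl, hi⟩
      · rw [attach_addDoubledEdgeHalfEdge_self] at hk; exact absurd hk (by simp)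
      · rw [attach_addDoubledEdgeHalfEdge h₀ kn] at hk
        rw [addDoubledEdgeColoring_base]
        exact h2 h₀ k (Sum.inl_injective hh) (Sum.inl_injective hk) kn.symm
      · exact absurd rfl hne
      · rw [hi] at hk; exact absurd hk (by simp)
    · rw [hi] at hh; exact absurd hh (by simp)

theorem HasCut.addDoubledEdge_inr (he : Γ.HasCut (Γ.attach h₀)) :
    (Γ.addDoubledEdge h₀).HasCut (Sum.inr 0) := by
  classical
  obtain ⟨f, c, h1, h2, h3⟩ := he.exists_of_halfEdge rfl
  refine ⟨addDoubledEdgeColoring h₀ f true,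
    Sum.elim (fun e => if e = Γ.attach h₀ then true else c e) (fun _ => true),
    fun h' hh => ?_, ?_⟩
  · rcases addDoubledEdge_halfEdge_cases h₀ h' with rfl | ⟨h, hne, rfl⟩ | rfl | ⟨b, i, rfl, hi⟩
    · exact absurd (attach_addDoubledEdgeHalfEdge_self h₀) hh
    · rw [attach_addDoubledEdgeHalfEdge h₀ hne, addDoubledEdgeColoring_base, Sum.elim_inl]
      split_ifs with h4
      · exact h3 h h4 hne
      · exact h1 h h4
    · exact (if_pos rfl).symm
    · rw [hi]; rfl
  · have key : ∀ h', (Γ.addDoubledEdge h₀).attach h' = Sum.inr 0 →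
        h' = addDoubledEdgeHalfEdge h₀ h₀ ∨ h' = Sum.inl (Sum.inr true, 0) := by
      intro h' hh
      rcases addDoubledEdge_halfEdge_cases h₀ h' with rfl | ⟨h, hne, rfl⟩ | rfl | ⟨b, i, rfl, hi⟩
      · exact Or.inl rfl
      · rw [attach_addDoubledEdgeHalfEdge h₀ hne] at hh; exact absurd hh (by simp)
      · exact absurd hh (by intro h; cases h)
      · rw [hi] at hh
        obtain rfl := Sum.inr_injective hh
        rcases b with _ | _
        · cases hi
        · exact Or.inr rfl
    intro h' k' hh hk hne
    rcases key h' hh with rfl | rfl <;> rcases key k' hk with rfl | rfl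
    · exact absurd rfl hne
    · rw [addDoubledEdgeColoring_base, h2]; exact Bool.false_ne_true
    · rw [addDoubledEdgeColoring_base, h2]; exact Bool.true_eq_false_eq_False
    · exact absurd rfl hne

/-- The kinds of the edges after a doubled edge has been inserted. -/
def addDoubledEdgeKind (kind : Γ.E → EdgeKind) : (Γ.addDoubledEdge h₀).E → EdgeKind :=
  Sum.elim kind ![.separating, .halfSum, .halfDiff]

theorem addDoubledEdgeKind_attach {kind : Γ.E → EdgeKind} (hk : kind (Γ.attach h₀) = .separating)
    (h : Γ.HalfEdge) : addDoubledEdgeKind h₀ kind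
      ((Γ.addDoubledEdge h₀).attach (addDoubledEdgeHalfEdge h₀ h)) = kind (Γ.attach h) := by
  by_cases hne : h = h₀
  · rw [hne, attach_addDoubledEdgeHalfEdge_self, hk]; rfl
  · rw [attach_addDoubledEdgeHalfEdge h₀ hne]; rfl

theorem EdgeRoles.addDoubledEdge {tree : Set Γ.V} {kind : Γ.E → EdgeKind} {τ : Γ.E → Γ.E}
    (h : Γ.EdgeRoles tree kind τ) (he : Γ.HasCut (Γ.attach h₀))
    {tree' : Set (Γ.addDoubledEdge h₀).V}
    (htree : ∀ v ∈ tree, (Sum.inl v : Γ.V ⊕ Bool) ∈ tree') :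
    (Γ.addDoubledEdge h₀).EdgeRoles tree' (addDoubledEdgeKind h₀ kind)
      (Sum.map τ ![0, 2, 1]) where
  connected := h.connected.addDoubledEdge h₀
  hasCut e hk := by
    rcases e with e | i
    · exact (h.hasCut e hk).addDoubledEdge h₀
    · fin_cases i
      · exact he.addDoubledEdge_inr h₀
      · cases hk
      · cases hk
  kind_leafEdge m := (addDoubledEdgeKind_attach h₀ (h.kind_eq_of_hasCut he) (Sum.inr m)).trans
    (h.kind_leafEdge m)
  trinode v := by
    have hsep := h.kind_eq_of_hasCut he
    have hkind : ∀ v i, addDoubledEdgeKind h₀ kind ((Γ.addDoubledEdge h₀).edgeAt (Sum.inl v) i) =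
        kind (Γ.edgeAt v i) := fun v i => addDoubledEdgeKind_attach h₀ hsep (Sum.inl (v, i))
    -- an edge that is not separating is not subdivided
    have hedge : ∀ v i, kind (Γ.edgeAt v i) ≠ .separating →
        (Γ.addDoubledEdge h₀).edgeAt (Sum.inl v) i = Sum.inl (Γ.edgeAt v i) := fun v i hi =>
      attach_addDoubledEdgeHalfEdge h₀ (h := Sum.inl (v, i)) fun h1 => hi (by rw [← hsep, ← h1])
    rcases v with v | b
    · rcases h.trinode v with ⟨h0, h1⟩ | ⟨i, j, k, hij, hjk, hik, h1, h2, h3⟩ |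
        ⟨i, j, k, hij, hjk, hik, h0, h1, h2, h3, h4, u, hu, j', k', hj, hk⟩
      · exact Or.inl ⟨htree v h0, fun i => (hkind v i).trans (h1 i)⟩
      · refine Or.inr (Or.inl ⟨i, j, k, hij, hjk, hik, ?_, (hkind v i).trans h2,
          (hkind v j).trans h3⟩)
        rw [hedge v j (by simp [h3]), hedge v k (by simp [← h1, h3]), h1]
      · have ej := hedge v j (by simp [h3])
        have ek := hedge v k (by simp [h4])
        refine Or.inr (Or.inr ⟨i, j, k, hij, hjk, hik, ?_, ?_, (hkind v i).trans h2,
          (hkind v j).trans h3, (hkind v k).trans h4, Sum.inl u,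
          fun h5 => hu (Sum.inl_injective h5), j', k', ?_, ?_⟩)
        · rw [ej, ek]; exact congrArg Sum.inl h0
        · rw [ej, ek]; exact congrArg Sum.inl h1
        · rw [ej, hedge u j' (by simp [hj, h3]), hj]
        · rw [ek, hedge u k' (by simp [hk, h4]), hk]
    · refine Or.inr (Or.inr ⟨0, 1, 2, by decide, by decide, by decide, ?_, ?_, ?_, ?_, ?_,
        Sum.inr (!b), ?_, 1, 2, ?_, ?_⟩) <;> rcases b with _ | _ <;>
        first | rfl | exact hsep | (intro h; cases h)

end AddDoubledEdge

/-! ### Caterpillar graphs have alcoved coordinates -/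

theorem ObtainedFrom.exists_edgeRoles {T Γ : TrivalentGraph} {ι : T.V → Γ.V} (hT : T.IsTree)
    (h : ObtainedFrom T Γ ι) : ∃ kind τ, Γ.EdgeRoles (Set.range ι) kind τ := by
  induction h with
  | refl => exact ⟨_, _, by rw [Set.range_id]; exact EdgeRoles.of_isTree hT⟩
  | @loop Γ ι l _ ih =>
    obtain ⟨kind, τ, h⟩ := ih
    refine ⟨fun e : Option Γ.E => e.elim .loop kind, Option.map τ, ?_⟩
    exact h.addLoop l (by rintro _ ⟨v, rfl⟩; exact ⟨v, rfl⟩)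
  | @doubledEdge Γ ι h₀ hs _ ih =>
    obtain ⟨kind, τ, h⟩ := ih
    refine ⟨addDoubledEdgeKind h₀ kind, Sum.map τ ![0, 2, 1], ?_⟩
    exact h.addDoubledEdge h₀ (h.connected.hasCut hs) (by rintro _ ⟨v, rfl⟩; exact ⟨v, rfl⟩)

theorem TrinodeShape.add {kind : Γ.E → EdgeKind} {τ : Γ.E → Γ.E} {ρ : Γ.Leaf → ℕ}
    {θ δ : Γ.E → ℤ} {v : Γ.V} (h : TrinodeShape Γ kind τ ρ θ v)
    (hδ : ∀ i i', δ (Γ.edgeAt v i) = δ (Γ.edgeAt v i')) :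
    TrinodeShape Γ kind τ ρ (fun e => θ e + δ e) v := by
  rcases h with ⟨i, j, k, l, hij, hjk, hik, h1, h2, h3, h4⟩ |
    ⟨i, j, k, hij, hjk, hik, h1, h2, h3, h4⟩ |
    ⟨i, j, k, hij, hjk, hik, h1, h2, h3, h4, h5, h6, h7⟩
  · have := hδ i j
    exact .leaf i j k l hij hjk hik h1 h2 h3 (by omega)
  · have := hδ i j
    exact .loop i j k hij hjk hik h1 h2 h3 (by omega)
  · have := hδ i j
    have := hδ i k
    exact .doubled i j k hij hjk hik h1 h2 h3 h4 h5 (by omega) (by omega)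

/-- Parities exist if they exist for every trinode separately, without affecting the other
trinodes. -/
theorem exists_parity_of_local {kind : Γ.E → EdgeKind} {τ : Γ.E → Γ.E} {ρ : Γ.Leaf → ℕ}
    (h : ∀ v, ∃ θ : Γ.E → ℤ, TrinodeShape Γ kind τ ρ θ v ∧
      ∀ u, u ≠ v → ∀ i i', θ (Γ.edgeAt u i) = θ (Γ.edgeAt u i')) :
    ∃ ε : Γ.E → ℤ, ∀ v, TrinodeShape Γ kind τ ρ ε v := by
  classical
  have := Γ.finite_V
  have := Fintype.ofFinite Γ.V
  choose θ h1 h2 using h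
  refine ⟨fun e => ∑ v, θ v e, fun v => ?_⟩
  have := (h1 v).add (δ := fun e => ∑ u ∈ Finset.univ.erase v, θ u e) fun i i' =>
    Finset.sum_congr rfl fun u hu => h2 u v (Finset.ne_of_mem_erase hu).symm i i'
  have hsum : (fun e => θ v e + ∑ u ∈ Finset.univ.erase v, θ u e) = fun e => ∑ u, θ u e :=
    funext fun e => Finset.add_sum_erase _ (fun u => θ u e) (Finset.mem_univ v)
  rwa [hsum] at this

theorem exists_third (k : Fin 3) : ∃ i j : Fin 3, i ≠ j ∧ j ≠ k ∧ i ≠ k := by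
  revert k; decide

theorem EdgeRoles.isCaterpillarShape {tree : Set Γ.V} {kind : Γ.E → EdgeKind} {τ : Γ.E → Γ.E}
    (h : Γ.EdgeRoles tree kind τ) (hleaf : ∀ v ∈ tree, Γ.HasLeaf v) :
    IsCaterpillarShape Γ kind τ where
  kind_leafEdge := h.kind_leafEdge
  even_of_separating k hv hl e he := (h.hasCut e he).even k hv hl
  exists_parity ρ := by
    refine exists_parity_of_local fun v => ?_
    rcases h.trinode v with ⟨h0, h1⟩ | ⟨i, j, k, hij, hjk, hik, h1, h2, h3⟩ |
      ⟨i, j, k, hij, hjk, hik, h0, h1, h2, h3, h4, -⟩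
    · obtain ⟨k, l, hl⟩ := hleaf v h0
      obtain ⟨i, j, hij, hjk, hik⟩ := exists_third k
      obtain ⟨η, hη, hi, hη0⟩ := (h.hasCut _ (h1 i)).exists_indicator
      refine ⟨fun e => ρ l * η e, .leaf i j k l hij hjk hik hl (h1 i) (h1 j) ?_,
        fun u hu i i' => congrArg (fun x : ℤ => ρ l * x) (hη u hu i i')⟩
      rw [hi, hη0 j hij.symm]; simp
    · exact ⟨0, .loop i j k hij hjk hik h1 h2 h3 (by simp), fun _ _ _ _ => rfl⟩
    · exact ⟨0, .doubled i j k hij hjk hik h0 h1 h2 h3 h4 (by simp) (by simp),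
        fun _ _ _ _ => rfl⟩

theorem IsCaterpillarShape.of_isIsomorphic {Γ Γ' : TrivalentGraph} (hiso : Γ.IsIsomorphic Γ')
    {kind : Γ.E → EdgeKind} {τ : Γ.E → Γ.E} (h : IsCaterpillarShape Γ kind τ) :
    ∃ kind' τ', IsCaterpillarShape Γ' kind' τ' := by
  obtain ⟨a, b, c, hc, ha⟩ := hiso
  refine ⟨fun e => kind (b.symm e), fun e => b (τ (b.symm e)), ⟨fun l => ?_, ?_, fun ρ => ?_⟩⟩
  · rw [← c.apply_symm_apply l, hc, b.symm_apply_apply]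
    exact h.kind_leafEdge _
  · intro k hv hl e he
    have := h.even_of_separating (fun e => k (b e)) (fun v => ?_) (fun l => ?_) _ he
    · simpa using this
    · obtain ⟨s, hs⟩ := ha v
      have h1 := hv (a v)
      rw [sum_perm (fun i => k (Γ'.edgeAt (a v) i)) (s.injective.ne (show (0 : Fin 3) ≠ 1 by decide))
        (s.injective.ne (show (1 : Fin 3) ≠ 2 by decide))
        (s.injective.ne (show (0 : Fin 3) ≠ 2 by decide))] at h1
      simpa only [hs] using h1
    · rw [← hc]; exact hl _
  · obtain ⟨ε, hε⟩ := h.exists_parity (fun l => ρ (c l))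
    refine ⟨fun e => ε (b.symm e), fun v => ?_⟩
    obtain ⟨v, rfl⟩ := a.surjective v
    obtain ⟨s, hs⟩ := ha v
    rcases hε v with ⟨i, j, k, l, hij, hjk, hik, h1, h2, h3, h4⟩ |
      ⟨i, j, k, hij, hjk, hik, h1, h2, h3, h4⟩ |
      ⟨i, j, k, hij, hjk, hik, h1, h2, h3, h4, h5, h6, h7⟩
    · refine .leaf (s i) (s j) (s k) (c l) (s.injective.ne hij) (s.injective.ne hjk)
        (s.injective.ne hik) ?_ ?_ ?_ ?_
      · rw [hs, h1, hc]
      all_goals simpa only [hs, b.symm_apply_apply]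
    · refine .loop (s i) (s j) (s k) (s.injective.ne hij) (s.injective.ne hjk)
        (s.injective.ne hik) ?_ ?_ ?_ ?_
      · rw [hs, hs, h1]
      all_goals simpa only [hs, b.symm_apply_apply]
    · refine .doubled (s i) (s j) (s k) (s.injective.ne hij) (s.injective.ne hjk)
        (s.injective.ne hik) ?_ ?_ ?_ ?_ ?_ ?_ ?_
      · rw [hs, hs, b.symm_apply_apply, h1]
      · rw [hs, hs, b.symm_apply_apply, h2]
      all_goals simpa only [hs, b.symm_apply_apply]

theorem IsCaterpillarGraph.exists_isCaterpillarShape (hΓ : Γ.IsCaterpillarGraph) :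
    ∃ kind τ, IsCaterpillarShape Γ kind τ := by
  obtain ⟨T, Γ', ι, hT, hob, hleaf, hiso⟩ := hΓ
  obtain ⟨kind, τ, h⟩ := hob.exists_edgeRoles hT.1
  refine IsCaterpillarShape.of_isIsomorphic hiso (h.isCaterpillarShape ?_)
  rintro _ ⟨v, rfl⟩
  exact hleaf v

end TrivalentGraph

theorem mainTheorem3 (Γ : TrivalentGraph) (hΓ : Γ.IsCaterpillarGraph)
    (r : Γ.Leaf → ℕ) (L : ℕ) :
    LatticePolytope.GeneratedInDegreeOne Γ.lattice (Γ.polytope (fun l => 2 * r l) (2 * L)) ∧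
    HasQuadraticSquarefreeGroebnerBasis
      (LatticePolytope.toricIdeal Γ.lattice (Γ.polytope (fun l => 2 * r l) (2 * L))) := by
  have := Γ.finite_E
  have := Fintype.ofFinite Γ.E
  have := Γ.finite_latticePoints (fun l => 2 * r l) (2 * L)
  obtain ⟨kind, τ, h⟩ := hΓ.exists_isCaterpillarShape
  obtain ⟨ε, hε⟩ := h.alcovedCoordinates r L
  exact ⟨hε.generatedInDegreeOne, hε.hasQuadraticSquarefreeGroebnerBasis⟩
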